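/- **Model.** A user has data $\theta\sim\mathcal N(0,I_d)$. Platform $i\in\{1,\dots,K\}$ has a unit vector $x_i\in\mathbb R^d$ and a cost $c_i\ge 0$; a data buyer has a unit vector $y\in\mathbb R^d$. With $\gamma_i=x_i^\top y$, assume $(x_i-\gamma_i y)^\top(x_j-\gamma_j y)=0$ for $i\ne j$. If the user shares with platform $i$, the platform receives $s_i=x_i^\top\theta+\mathcal N(0,1)$; its sold signal is $\tilde s_i=s_i+\mathcal N(0,\sigma_i^2)$, all noises being independent ($\sigma_i=\infty$ means that nothing is conveyed). The information about $Z$ revealed by a set of signals is $\mathcal I(Z\mid\mathcal S)=\mathbb E[(Z-\mathbb E Z)^2]-\mathbb E[(Z-\mathbb E[Z\mid \mathcal S])^2]$. The game has four stages: (1) the platforms simultaneously choose noise levels $\sigma_i$ and entry decisions $e_i\in\{0,1\}$; (2) the user chooses $a\in\{0,1\}^K$; (3) the platforms simultaneously choose prices $p_i\in\mathbb R$; (4) the buyer chooses $b\in\{0,1\}^K$. The buyer observes $\tilde s_i$ for the $i$ with $e_i=a_i=b_i=1$; let $\mathcal I$ be the information this reveals about $y^\top\theta$, and let $\mathcal I_i=\mathcal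 I(x_i^\top\theta\mid s_i)$. For a platform with $e_ia_i=0$ the price counts as $0$. The user's utility is $\sum_i a_ie_i\mathcal I_i-\alpha\,\mathcal I$; platform $i$'s utility is $a_i\mathcal I_i+b_ip_i-c_i$ if $e_i=1$ and $0$ otherwise; the buyer's utility is $\beta\,\mathcal I-\sum_i b_ip_i$, with $\beta\ge 0$. *Equilibrium* means pure-strategy subgame perfect equilibrium in which the user chooses the greatest of its optimal sharing profiles (and, if $\beta=0$, the buyer takes the data offered to it on the path of every pricing subgame). Assume that $\alpha$ is such that, whichever platforms enter, if all noise levels are $0$ and the buyer buys everything, then sharing with none of the entered platforms is the user's only optimal choice. Platform $i$ is *low-cost* if $c_i<\tfrac12$ and *high-cost* if $c_i>\tfrac12$; assume that every platform is one or the other. A *minimum privacy mandate* is $\bar{\boldsymbol\sigma}\in[0,\infty]^K$: platform $i$ must choose a finite $\sigma_i\ge\bar\sigma_i$ if $\bar\sigma_i<\infty$, and $\sigma_i=\infty$ if $\bar\sigma_i=\infty$. It is *uniform* if all $\bar\sigma_i$ are equal; the *ban* is $\bar\sigma_i=\infty$ for all $i$. **Proposition.** For every such $\alpha$ the following holds.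 1. Suppose that all platforms are low-cost. For every $\beta\ge 0$ an equilibrium under the ban exists, and for every mandate, in every equilibrium under it, all platforms enter and the user's utility is at most that in any equilibrium under the ban; it is strictly smaller unless the mandate is the ban. 2. Suppose that at least one platform is high-cost. Then there are $\tilde\beta$, $\underline\beta>0$ and $\bar\sigma\in[0,\infty)$ such that: (a) for every $\beta\ge 0$ with $\beta\ge\tilde\beta$, equilibria exist under the ban and under the uniform mandate $\bar\sigma$, and in every equilibrium under the uniform mandate $\bar\sigma$ all platforms enter and the user's utility is strictly higher than in any equilibrium under the ban; (b) for every $0\le\beta\le\underline\beta$, an equilibrium under the ban exists, and for every mandate (uniform or not), in every equilibrium under it, exactly the low-cost platforms enter and the user's utility is at most that in any equilibrium under the ban; it is strictly smaller if some low-cost platform is not banned ($\bar\sigma_i<\infty$). -/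

import Mathlib

open MeasureTheory ProbabilityTheory
open scoped ENNReal NNReal

/-- The exogenous data of a three-layer data market with `K` platforms and a `d`-dimensional user:
the unit-norm characteristics `x i` of the platforms, the unit-norm characteristic `y` of the data
buyer and the nonnegative service costs `c i`. -/
structure DataMarket (d K : ℕ) where
  x : Fin K → EuclideanSpace ℝ (Fin d)
  y : EuclideanSpace ℝ (Fin d)
  c : Fin K → ℝ
  norm_x : ∀ i, ‖x i‖ = 1
  norm_y : ‖y‖ = 1
  cost_nonneg : ∀ i, 0 ≤ c i

/-- The sample space: the user's feature vector `θ`, the noises in the signals received by the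
platforms, and the (normalised) noises that the platforms add before selling the data. -/
abbrev SampleSpace (d K : ℕ) : Type :=
  EuclideanSpace ℝ (Fin d) × (Fin K → ℝ) × (Fin K → ℝ)

/-- `θ` is standard Gaussian, all noises are standard Gaussian, everything is independent. -/
noncomputable def sampleLaw (d K : ℕ) : Measure (SampleSpace d K) :=
  (stdGaussian (EuclideanSpace ℝ (Fin d))).prod
    ((Measure.pi fun _ => gaussianReal 0 1).prod (Measure.pi fun _ => gaussianReal 0 1))

/-- Revealed information about `Z` from observing the `σ`-algebra `𝒮`: the reduction of the mean
squared error when the prior mean is replaced by the posterior mean. -/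
noncomputable def revealedInfo {Ω : Type*} {m₀ : MeasurableSpace Ω} (μ : Measure Ω)
    (Z : Ω → ℝ) (𝒮 : MeasurableSpace Ω) : ℝ :=
  (∫ ω, (Z ω - ∫ ω', Z ω' ∂μ) ^ 2 ∂μ) - ∫ ω, (Z ω - (μ[Z | 𝒮]) ω) ^ 2 ∂μ

namespace DataMarket

variable {d K : ℕ} (M : DataMarket d K)

/-- The correlation between platform `i`'s data and the data buyer. -/
noncomputable def gam (i : Fin K) : ℝ := inner ℝ (M.x i) M.y

/-- The components of the platforms' characteristics orthogonal to the buyer's characteristic are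
pairwise orthogonal (the data of different platforms are substitutes for the buyer). -/
def Substitutes : Prop :=
  ∀ i j, i ≠ j → inner ℝ (M.x i - M.gam i • M.y) (M.x j - M.gam j • M.y) = (0 : ℝ)

/-- Low-cost platforms. -/
def LowCost (i : Fin K) : Prop := M.c i < 1 / 2

/-- High-cost platforms. -/
def HighCost (i : Fin K) : Prop := 1 / 2 < M.c i

/-- The signal `s i = ⟨x i, θ⟩ + N(0,1)` that platform `i` receives from a sharing user. -/
noncomputable def signal (i : Fin K) (ω : SampleSpace d K) : ℝ :=
  inner ℝ (M.x i) ω.1 + ω.2.1 i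

/-- The signal `s i + N(0, t ^ 2)` that platform `i` sells when its noise level is `t`. -/
noncomputable def soldSignal (i : Fin K) (t : ℝ) (ω : SampleSpace d K) : ℝ :=
  M.signal i ω + t * ω.2.2 i

/-- What the buyer observes when it holds the data of the platforms in `S` under the noise levels
`σ`; a platform with infinite noise level conveys nothing. -/
@[reducible] noncomputable def buyerObs (σ : Fin K → ℝ≥0∞) (S : Finset (Fin K)) :
    MeasurableSpace (SampleSpace d K) :=
  ⨆ i ∈ S, ⨆ _ : σ i ≠ ⊤,
    MeasurableSpace.comap (M.soldSignal i (σ i).toReal) (borel ℝ)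

/-- The information about `⟨x i, θ⟩` revealed to platform `i` by its signal. -/
noncomputable def serviceInfo (i : Fin K) : ℝ :=
  revealedInfo (sampleLaw d K) (fun ω => inner ℝ (M.x i) ω.1)
    (MeasurableSpace.comap (M.signal i) (borel ℝ))

/-- The information about `⟨y, θ⟩` revealed to the buyer by the data of the platforms in `S`. -/
noncomputable def leak (σ : Fin K → ℝ≥0∞) (S : Finset (Fin K)) : ℝ :=
  revealedInfo (sampleLaw d K) (fun ω => inner ℝ M.y ω.1) (M.buyerObs σ S)

/-! Decisions in `{0,1}^K` are represented by the set of platforms at which the value is `1`: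
`e` the platforms that enter, `a` those with which the user shares, `b` those whose offer the buyer
accepts.  Data of platform `i` reach the buyer iff `i ∈ e ∩ a ∩ b`; a platform outside `e ∩ a` has
no data to sell and its price is irrelevant (counted as zero). -/

/-- The user's utility. -/
noncomputable def userUtility (α : ℝ) (σ : Fin K → ℝ≥0∞) (e a b : Finset (Fin K)) : ℝ :=
  (∑ i ∈ e ∩ a, M.serviceInfo i) - α * M.leak σ (e ∩ a ∩ b)

/-- The utility of platform `i`. -/
noncomputable def platformUtility (i : Fin K) (e a : Finset (Fin K)) (p : Fin K → ℝ)
    (b : Finset (Fin K)) : ℝ :=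
  if i ∈ e then
    (if i ∈ a then M.serviceInfo i else 0) + (if i ∈ a ∧ i ∈ b then p i else 0) - M.c i
  else 0

/-- The data buyer's utility. -/
noncomputable def buyerUtility (β : ℝ) (σ : Fin K → ℝ≥0∞) (e a : Finset (Fin K)) (p : Fin K → ℝ)
    (b : Finset (Fin K)) : ℝ :=
  β * M.leak σ (e ∩ a ∩ b) - ∑ i ∈ e ∩ a ∩ b, p i

/-- Standing assumption on the privacy weight `α`: whichever platforms enter, if they add no noise
and the buyer buys all the data offered, then the user optimally shares with none of them. -/
def AsksForPrivacy (α : ℝ) : Prop :=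
  ∀ e a : Finset (Fin K),
    (∀ a', M.userUtility α 0 e a' Finset.univ ≤ M.userUtility α 0 e a Finset.univ) →
      Disjoint a e

end DataMarket

/-- The noise levels that the platforms may choose under the minimum privacy mandate `m`: each at
least `m i`, and finite unless platform `i` is banned from selling data (`m i = ∞`). -/
def MandateFeasible {K : ℕ} (m σ : Fin K → ℝ≥0∞) : Prop :=
  ∀ i, m i ≤ σ i ∧ (m i ≠ ⊤ → σ i ≠ ⊤)

/-- The uniform minimum privacy mandate. -/
def uniformMandate (K : ℕ) (s : ℝ≥0) : Fin K → ℝ≥0∞ := fun _ => (s : ℝ≥0∞)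

/-- Banning all platforms from sharing data with the buyer. -/
def dataBan (K : ℕ) : Fin K → ℝ≥0∞ := fun _ => ⊤

/-- A profile of (pure) strategies in the four-stage game: noise levels and entry; the user's
sharing decision after every `(σ, e)`; the prices after every `(σ, e, a)`; the buyer's purchases
after every `(σ, e, a, p)`. -/
structure StrategyProfile (K : ℕ) where
  noise : Fin K → ℝ≥0∞
  entry : Finset (Fin K)
  share : (Fin K → ℝ≥0∞) → Finset (Fin K) → Finset (Fin K)
  price : (Fin K → ℝ≥0∞) → Finset (Fin K) → Finset (Fin K) → Fin K → ℝ
  buy : (Fin K → ℝ≥0∞) → Finset (Fin K) → Finset (Fin K) → (Fin K → ℝ) → Finset (Fin K)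

namespace StrategyProfile

variable {K : ℕ} (s : StrategyProfile K)

/-- The prices resulting from the first-stage decisions `(σ, e)`. -/
def priceAfter (σ : Fin K → ℝ≥0∞) (e : Finset (Fin K)) : Fin K → ℝ :=
  s.price σ e (s.share σ e)

/-- The purchases resulting from the decisions `(σ, e)` and `a`. -/
def buyAfter (σ : Fin K → ℝ≥0∞) (e a : Finset (Fin K)) : Finset (Fin K) :=
  s.buy σ e a (s.price σ e a)

end StrategyProfile

namespace DataMarket

variable {d K : ℕ} (M : DataMarket d K)

/-- Subgame perfect equilibrium under the minimum privacy mandate `m`.  Ties of the user are broken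
in favour of the platforms: the user takes the greatest of its optimal sharing profiles. -/
structure IsEquilibrium (α β : ℝ) (m : Fin K → ℝ≥0∞) (s : StrategyProfile K) : Prop where
  feasible : MandateFeasible m s.noise
  /-- Stage 4: the buyer's purchases maximise its utility. -/
  buyer_opt : ∀ σ, MandateFeasible m σ → ∀ e a p b,
    M.buyerUtility β σ e a p b ≤ M.buyerUtility β σ e a p (s.buy σ e a p)
  /-- Stage 3: no platform gains by changing its price. -/
  price_opt : ∀ σ, MandateFeasible m σ → ∀ e a i (q : ℝ),
    M.platformUtility i e a (Function.update (s.price σ e a) i q)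
        (s.buy σ e a (Function.update (s.price σ e a) i q)) ≤
      M.platformUtility i e a (s.price σ e a) (s.buyAfter σ e a)
  /-- Only relevant if data are worthless to the buyer: then it takes the data offered
  (necessarily for free) to it. -/
  buyer_tie : β = 0 → ∀ σ, MandateFeasible m σ → ∀ e a, e ∩ a ⊆ s.buyAfter σ e a
  /-- Stage 2: the user's sharing profile is the greatest maximiser of its utility. -/
  user_opt : ∀ σ, MandateFeasible m σ → ∀ e,
    IsGreatest {a | ∀ a', M.userUtility α σ e a' (s.buyAfter σ e a') ≤
      M.userUtility α σ e a (s.buyAfter σ e a)} (s.share σ e)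
  /-- Stage 1: no platform gains by changing its noise level and its entry decision. -/
  platform_opt : ∀ i σ e, MandateFeasible m σ →
    (∀ j, j ≠ i → σ j = s.noise j ∧ (j ∈ e ↔ j ∈ s.entry)) →
    M.platformUtility i e (s.share σ e) (s.priceAfter σ e)
        (s.buyAfter σ e (s.share σ e)) ≤
      M.platformUtility i s.entry (s.share s.noise s.entry) (s.priceAfter s.noise s.entry)
        (s.buyAfter s.noise s.entry (s.share s.noise s.entry))

/-- The user's utility on the path of play of `s`. -/
noncomputable def userPayoff (α : ℝ) (s : StrategyProfile K) : ℝ :=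
  M.userUtility α s.noise s.entry (s.share s.noise s.entry)
    (s.buyAfter s.noise s.entry (s.share s.noise s.entry))

end DataMarket

/-!
Everything observed is jointly Gaussian, so posterior means are linear regressions. Subtracting from
the platforms' characteristics their projections on the buyer's one leaves orthogonal residuals;
hence, given `⟪y, θ⟫`, the sold signals are independent, their signal-to-noise ratios `snr` add up to
some `H`, and the buyer learns `H / (1 + H)` (`DataMarket.leak_eq`), an increasing concave function
of `H`. Every platform that is shared with learns `1 / 2` (`DataMarket.serviceInfo_eq`).

By concavity data are substitutes for the buyer, so in every equilibrium of a pricing subgame all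
informative data on offer are sold and each seller earns its marginal value (`pricing_outcome`).
The user therefore maximises a supermodular function (`sharingValue`), and shares with every
platform whose signal-to-noise ratio is below `1 / (2 α)` (`DataMarket.IsContinuation.mem_share`).
A low-cost platform can guarantee itself a positive utility by adding that much noise, so it always
enters and is shared with (`DataMarket.IsEquilibrium.lowCost_mem`). A high-cost platform enters only
if data sales cover its loss on the service, which they cannot under the ban or for a small `β`.

Hence the ban gives the user `1 / 2` per low-cost platform and no loss of privacy, and whenever only
low-cost platforms enter, any data sale makes the user worse off. If `β` is large, however, the sales
cover all costs even at the noise level of `DataMarket.AsksForPrivacy.exists_noise`, at which the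
total loss of privacy is worth less than one service: under that uniform mandate all platforms
enter, and the user gains the service of the high-cost ones
(`DataMarket.IsEquilibrium.entry_of_uniformMandate`).
-/

/-! ### Information revealed by Gaussian observations -/

/-- A random variable that differs from an observable `P` by a centred residual independent of the
observations has `P` as its posterior mean. -/
theorem condExp_eq_of_indep_sub {Ω : Type*} {𝒮 mΩ : MeasurableSpace Ω} {μ : Measure Ω}
    [IsProbabilityMeasure μ] (hle : 𝒮 ≤ mΩ) {Z P : Ω → ℝ} (hP : StronglyMeasurable[𝒮] P)
    (hPi : Integrable P μ) (hRm : Measurable (Z - P)) (hRi : Integrable (Z - P) μ)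
    (hR0 : ∫ ω, (Z - P) ω ∂μ = 0)
    (hind : Indep (MeasurableSpace.comap (Z - P) (borel ℝ)) 𝒮 μ) :
    μ[Z | 𝒮] =ᵐ[μ] P := by
  have hRle : MeasurableSpace.comap (Z - P) (borel ℝ) ≤ mΩ := by
    rw [← BorelSpace.measurable_eq (α := ℝ)]; exact hRm.comap_le
  have hcondR : μ[Z - P | 𝒮] =ᵐ[μ] fun _ => 0 := by
    have h := condExp_indep_eq (μ := μ) (f := Z - P) hRle hle ?_ hind
    · rwa [hR0] at h
    · refine Measurable.stronglyMeasurable ?_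
      rw [← BorelSpace.measurable_eq (α := ℝ)]
      exact comap_measurable _
  have h1 : P + (Z - P) = Z := add_sub_cancel P Z
  have h2 := condExp_add hPi hRi 𝒮
  rw [h1, condExp_of_stronglyMeasurable hle hP hPi] at h2
  filter_upwards [h2, hcondR] with ω h2 h3
  rw [h2, Pi.add_apply, h3, add_zero]

/-- Linear regression is optimal for a centred Gaussian law: if the residual `Z - ∑ c i • T i` is
uncorrelated with every `T j`, it is independent of them, so that the regression is the posterior
mean of `Z`, and the variance that it explains is `∑ c i * cov[Z, T i]`. -/
theorem revealedInfo_eq_of_residual_uncorrelated {E ι : Type*} [NormedAddCommGroup E]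
    [NormedSpace ℝ E] [MeasurableSpace E] [BorelSpace E] [SecondCountableTopology E]
    [CompleteSpace E] [Fintype ι]
    (μ : Measure E) [IsGaussian μ] (hmean : ∀ L : StrongDual ℝ E, ∫ ω, L ω ∂μ = 0)
    (Z : StrongDual ℝ E) (T : ι → StrongDual ℝ E) (c : ι → ℝ)
    (hres : ∀ j, cov[Z, T j; μ] = ∑ i, c i * cov[T i, T j; μ]) :
    revealedInfo μ Z (⨆ i, MeasurableSpace.comap (T i) (borel ℝ)) =
      ∑ i, c i * cov[Z, T i; μ] := by
  have hL2 : ∀ L : StrongDual ℝ E, MemLp L 2 μ := fun L => IsGaussian.memLp_dual μ L 2 (by simp)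
  set P : StrongDual ℝ E := ∑ i, c i • T i with hP
  have hcovP : ∀ L : StrongDual ℝ E, cov[P, L; μ] = ∑ i, c i * cov[T i, L; μ] := by
    intro L
    have : (P : E → ℝ) = fun ω => ∑ i, c i * T i ω := by
      ext ω; simp [hP]
    rw [this, covariance_fun_sum_left (fun i => (hL2 (T i)).const_mul (c i)) (hL2 L)]
    exact Finset.sum_congr rfl fun i _ => covariance_const_mul_left _
  have hcovR : ∀ L : StrongDual ℝ E, cov[(Z - P : StrongDual ℝ E), L; μ] =
      cov[Z, L; μ] - cov[P, L; μ] := fun L => covariance_sub_left (hL2 Z) (hL2 P) (hL2 L)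
  have hRT : ∀ j, cov[(Z - P : StrongDual ℝ E), T j; μ] = 0 := by
    intro j; rw [hcovR, hcovP, hres, sub_self]
  -- the residual is independent of the observations
  have hind : IndepFun ⇑(Z - P) (fun ω j => T j ω) μ := by
    refine IndepFun.comp (φ := fun x : Unit → ℝ => x ()) (ψ := id)
      (HasGaussianLaw.indepFun_of_covariance_eval (X := fun _ : Unit => ⇑(Z - P))
      (Y := fun j => ⇑(T j)) ?_ fun _ j => hRT j) (measurable_pi_apply _) measurable_id
    exact (IsGaussian.hasGaussianLaw_id (μ := μ)).map_fun
      ((ContinuousLinearMap.pi fun _ : Unit => Z - P).prod (ContinuousLinearMap.pi T))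
  have hTm : Measurable fun ω j => T j ω :=
    measurable_pi_lambda _ fun j => (T j).continuous.measurable
  have h𝒮 : (⨆ i, MeasurableSpace.comap (T i) (borel ℝ)) =
      MeasurableSpace.comap (fun ω j => T j ω) MeasurableSpace.pi := by
    rw [MeasurableSpace.pi, MeasurableSpace.comap_iSup]
    refine iSup_congr fun i => ?_
    rw [MeasurableSpace.comap_comp, BorelSpace.measurable_eq (α := ℝ)]
    rfl
  have hPm : StronglyMeasurable[⨆ i, MeasurableSpace.comap (T i) (borel ℝ)] P := by
    refine Measurable.stronglyMeasurable ?_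
    have : (P : E → ℝ) = fun ω => ∑ i, c i * T i ω := by
      ext ω; simp [hP]
    rw [this]
    refine Finset.measurable_sum _ fun i _ => Measurable.const_mul ?_ _
    exact Measurable.mono (comap_measurable (m := borel ℝ) (T i)) (le_iSup_of_le i le_rfl)
      (BorelSpace.measurable_eq (α := ℝ)).le
  have hPi : Integrable P μ := IsGaussian.integrable_dual μ P
  have hcond : μ[⇑Z | ⨆ i, MeasurableSpace.comap (T i) (borel ℝ)] =ᵐ[μ] P := by
    refine condExp_eq_of_indep_sub (h𝒮 ▸ hTm.comap_le) hPm hPi (Z - P).continuous.measurable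
      (IsGaussian.integrable_dual μ (Z - P)) (hmean (Z - P)) ?_
    rw [h𝒮, ← BorelSpace.measurable_eq (α := ℝ)]
    exact hind
  have hvar : ∀ L : StrongDual ℝ E, ∫ ω, L ω ^ 2 ∂μ = cov[L, L; μ] := by
    intro L
    rw [covariance_self L.continuous.aemeasurable,
      variance_of_integral_eq_zero L.continuous.aemeasurable (hmean L)]
  have h4 : ∫ ω, (Z ω - (μ[⇑Z | ⨆ i, MeasurableSpace.comap (T i) (borel ℝ)]) ω) ^ 2 ∂μ =
      ∫ ω, (Z - P) ω ^ 2 ∂μ := by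
    refine integral_congr_ae ?_
    filter_upwards [hcond] with ω h
    rw [h]; rfl
  have hRP : cov[(Z - P : StrongDual ℝ E), P; μ] = 0 := by
    rw [covariance_comm, hcovP]
    exact Finset.sum_eq_zero fun i _ => by rw [covariance_comm, hRT, mul_zero]
  rw [revealedInfo, h4, hvar, hmean]
  simp only [sub_zero]
  rw [hvar]
  have h5 : cov[(Z - P : StrongDual ℝ E), (Z - P : StrongDual ℝ E); μ] =
      cov[(Z - P : StrongDual ℝ E), Z; μ] := by
    have := covariance_sub_right (hL2 (Z - P)) (hL2 Z) (hL2 P)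
    rw [hRP, sub_zero] at this
    exact this
  rw [h5, hcovR, hcovP, sub_sub_cancel]
  exact Finset.sum_congr rfl fun i _ => by rw [covariance_comm]

/-! ### The law of the signals -/

instance isGaussian_pi_gaussianReal {ι : Type*} [Fintype ι] :
    IsGaussian (Measure.pi fun _ : ι => gaussianReal 0 1) := by
  have h : iIndepFun (fun (i : ι) (ω : ι → ℝ) => ω i) (Measure.pi fun _ : ι => gaussianReal 0 1) :=
    iIndepFun_pi (X := fun _ => id) fun _ => aemeasurable_id
  have h' := h.hasGaussianLaw fun i => ⟨by
    rw [(measurePreserving_eval (fun _ : ι => gaussianReal 0 1) i).map_eq]; infer_instance⟩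
  have := h'.isGaussian_map
  rwa [show (fun (ω : ι → ℝ) (i : ι) => ω i) = id from rfl, Measure.map_id] at this

instance isGaussian_sampleLaw (d K : ℕ) : IsGaussian (sampleLaw d K) := by
  unfold sampleLaw; infer_instance

theorem integral_dual_pi_gaussianReal {ι : Type*} [Fintype ι] (L : StrongDual ℝ (ι → ℝ)) :
    ∫ ω, L ω ∂(Measure.pi fun _ : ι => gaussianReal 0 1) = 0 := by
  classical
  rw [IsGaussian.integral_dual]
  have : ∫ x, x ∂(Measure.pi fun _ : ι => gaussianReal 0 1) = 0 := by
    ext i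
    rw [eval_integral fun i => integrable_eval IsGaussian.integrable_id]
    simp [integral_eval]
  rw [this, map_zero]

theorem integral_dual_sampleLaw {d K : ℕ} (L : StrongDual ℝ (SampleSpace d K)) :
    ∫ ω, L ω ∂(sampleLaw d K) = 0 := by
  unfold sampleLaw
  rw [integral_continuousLinearMap_prod' (IsGaussian.integrable_dual _ _)
    (IsGaussian.integrable_dual _ _), integral_strongDual_stdGaussian,
    integral_continuousLinearMap_prod' (IsGaussian.integrable_dual _ _)
    (IsGaussian.integrable_dual _ _), integral_dual_pi_gaussianReal, integral_dual_pi_gaussianReal]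
  simp

theorem covariance_comp_fst {α β : Type*} [MeasurableSpace α] [MeasurableSpace β] {μ : Measure α}
    {ν : Measure β} [IsProbabilityMeasure μ] [IsProbabilityMeasure ν] {f g : α → ℝ}
    (hf : AEStronglyMeasurable f μ) (hg : AEStronglyMeasurable g μ) :
    cov[fun ω => f ω.1, fun ω => g ω.1; μ.prod ν] = cov[f, g; μ] := by
  have h := (measurePreserving_fst (μ := μ) (ν := ν)).map_eq
  conv_rhs => rw [← h]
  exact (covariance_map_fun (by rwa [h]) (by rwa [h]) measurable_fst.aemeasurable).symm

theorem covariance_comp_snd {α β : Type*} [MeasurableSpace α] [MeasurableSpace β] {μ : Measure α}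
    {ν : Measure β} [IsProbabilityMeasure μ] [IsProbabilityMeasure ν] {f g : β → ℝ}
    (hf : AEStronglyMeasurable f ν) (hg : AEStronglyMeasurable g ν) :
    cov[fun ω => f ω.2, fun ω => g ω.2; μ.prod ν] = cov[f, g; ν] := by
  have h := (measurePreserving_snd (μ := μ) (ν := ν)).map_eq
  conv_rhs => rw [← h]
  exact (covariance_map_fun (by rwa [h]) (by rwa [h]) measurable_snd.aemeasurable).symm

theorem covariance_eval_pi_gaussianReal {ι : Type*} [Fintype ι] [DecidableEq ι] (i j : ι) :
    cov[fun ω => ω i, fun ω => ω j; Measure.pi fun _ : ι => gaussianReal 0 1] =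
      if i = j then 1 else 0 := by
  have hL2 : ∀ i : ι, MemLp (fun ω : ι → ℝ => ω i) 2 (Measure.pi fun _ : ι => gaussianReal 0 1) :=
    fun i => IsGaussian.memLp_dual _ (ContinuousLinearMap.proj i : StrongDual ℝ (ι → ℝ)) 2 (by simp)
  split_ifs with h
  · subst h
    rw [covariance_self (measurable_pi_apply i).aemeasurable]
    have hm := (measurePreserving_eval (fun _ : ι => gaussianReal 0 1) i).map_eq
    have := variance_map (X := id) (Y := fun ω : ι → ℝ => ω i)
      (μ := Measure.pi fun _ : ι => gaussianReal 0 1) aemeasurable_id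
      (measurable_pi_apply i).aemeasurable
    rw [show (fun ω : ι → ℝ => ω i) = Function.eval i from rfl, hm, variance_id_gaussianReal] at this
    simpa using this.symm
  · have hind : iIndepFun (fun (i : ι) (ω : ι → ℝ) => ω i)
        (Measure.pi fun _ : ι => gaussianReal 0 1) :=
      iIndepFun_pi (X := fun _ => id) fun _ => aemeasurable_id
    exact (hind.indepFun h).covariance_eq_zero (hL2 i) (hL2 j)

/-- The covariance matrix of independent standard Gaussian noises is the identity. -/
theorem covariance_sum_pi_gaussianReal {ι : Type*} [Fintype ι] (a b : ι → ℝ) :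
    cov[fun ω => ∑ i, a i * ω i, fun ω => ∑ i, b i * ω i;
      Measure.pi fun _ : ι => gaussianReal 0 1] = ∑ i, a i * b i := by
  classical
  have hpi : ∀ (a : ι → ℝ) (i : ι), MemLp (fun ω : ι → ℝ => a i * ω i) 2
      (Measure.pi fun _ : ι => gaussianReal 0 1) := fun a i =>
    (IsGaussian.memLp_dual _ (ContinuousLinearMap.proj i : StrongDual ℝ (ι → ℝ)) 2
      (by simp)).const_mul (a i)
  rw [covariance_fun_sum_fun_sum (hpi a) (hpi b)]
  simp [covariance_const_mul_left, covariance_const_mul_right, covariance_eval_pi_gaussianReal,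
    mul_comm]

/-- The functional `⟪u, θ⟫ + ∑ a i * ε i + ∑ b i * η i` of the user's data `θ`, the noises `ε` in
the signals received by the platforms and the noises `η` that the platforms add. -/
noncomputable def noisyFunctional {d K : ℕ} (u : EuclideanSpace ℝ (Fin d)) (a b : Fin K → ℝ) :
    StrongDual ℝ (SampleSpace d K) :=
  (innerSL ℝ u).comp (ContinuousLinearMap.fst ℝ _ _) +
    ((∑ i, a i • (ContinuousLinearMap.proj i : StrongDual ℝ (Fin K → ℝ))).comp
        (ContinuousLinearMap.fst ℝ _ _) +
      (∑ i, b i • (ContinuousLinearMap.proj i : StrongDual ℝ (Fin K → ℝ))).comp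
        (ContinuousLinearMap.snd ℝ _ _)).comp (ContinuousLinearMap.snd ℝ _ _)

theorem noisyFunctional_apply {d K : ℕ} (u : EuclideanSpace ℝ (Fin d)) (a b : Fin K → ℝ)
    (ω : SampleSpace d K) :
    noisyFunctional u a b ω =
      inner ℝ u ω.1 + (∑ i, a i * ω.2.1 i + ∑ i, b i * ω.2.2 i) := by
  simp [noisyFunctional]

/-- Two sums of functions of independent variables covary only within the factors. -/
theorem covariance_add_prod {α β : Type*} [MeasurableSpace α] [MeasurableSpace β] {μ : Measure α}
    {ν : Measure β} [IsProbabilityMeasure μ] [IsProbabilityMeasure ν] {f f' : α → ℝ} {g g' : β → ℝ}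
    (hf : MemLp f 2 μ) (hf' : MemLp f' 2 μ) (hg : MemLp g 2 ν) (hg' : MemLp g' 2 ν) :
    cov[fun ω => f ω.1 + g ω.2, fun ω => f' ω.1 + g' ω.2; μ.prod ν] =
      cov[f, f'; μ] + cov[g, g'; ν] := by
  have h := covariance_add_left (hf.comp_fst ν) (hg.comp_snd μ)
    ((hf'.comp_fst ν).add (hg'.comp_snd μ))
  rw [covariance_add_right (hf.comp_fst ν) (hf'.comp_fst ν) (hg'.comp_snd μ),
    covariance_add_right (hg.comp_snd μ) (hf'.comp_fst ν) (hg'.comp_snd μ)] at h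
  have h1 := covariance_fst_snd_prod hf hg'
  have h2 := covariance_fst_snd_prod hf' hg
  rw [covariance_comm] at h2
  have h3 := covariance_comp_fst (ν := ν) hf.aestronglyMeasurable hf'.aestronglyMeasurable
  have h4 := covariance_comp_snd (μ := μ) hg.aestronglyMeasurable hg'.aestronglyMeasurable
  refine h.trans ?_
  rw [← h3, ← h4]
  rw [h1, h2, add_zero, zero_add]

theorem covariance_noisyFunctional {d K : ℕ} (u v : EuclideanSpace ℝ (Fin d))
    (a b a' b' : Fin K → ℝ) :
    cov[noisyFunctional u a b, noisyFunctional v a' b'; sampleLaw d K] =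
      inner ℝ u v + (∑ i, a i * a' i + ∑ i, b i * b' i) := by
  have hpi : ∀ a : Fin K → ℝ, MemLp (fun ω : Fin K → ℝ => ∑ i, a i * ω i) 2
      (Measure.pi fun _ : Fin K => gaussianReal 0 1) := fun a => by
    convert IsGaussian.memLp_dual (Measure.pi fun _ : Fin K => gaussianReal 0 1)
      (∑ i, a i • (ContinuousLinearMap.proj i : StrongDual ℝ (Fin K → ℝ))) 2 (by simp) with ω
    simp
  have hin : ∀ u : EuclideanSpace ℝ (Fin d), MemLp (fun θ => inner ℝ u θ) 2
      (stdGaussian (EuclideanSpace ℝ (Fin d))) := fun u =>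
    IsGaussian.memLp_dual _ (innerSL ℝ u) 2 (by simp)
  have e : ∀ (u : EuclideanSpace ℝ (Fin d)) (a b : Fin K → ℝ), ⇑(noisyFunctional u a b) =
      fun ω => inner ℝ u ω.1 + (∑ i, a i * ω.2.1 i + ∑ i, b i * ω.2.2 i) :=
    fun u a b => funext fun ω => noisyFunctional_apply u a b ω
  rw [e, e, sampleLaw,
    covariance_add_prod (f := fun θ => inner ℝ u θ) (f' := fun θ => inner ℝ v θ)
      (g := fun n : (Fin K → ℝ) × (Fin K → ℝ) => ∑ i, a i * n.1 i + ∑ i, b i * n.2 i)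
      (g' := fun n : (Fin K → ℝ) × (Fin K → ℝ) => ∑ i, a' i * n.1 i + ∑ i, b' i * n.2 i)
      (hin u) (hin v) (((hpi a).comp_fst _).add ((hpi b).comp_snd _))
      (((hpi a').comp_fst _).add ((hpi b').comp_snd _)),
    covariance_add_prod (hpi a) (hpi a') (hpi b) (hpi b'),
    covariance_sum_pi_gaussianReal, covariance_sum_pi_gaussianReal,
    ← covarianceBilin_apply_eq_cov IsGaussian.memLp_two_id, covarianceBilin_stdGaussian]
  rfl

namespace DataMarket

variable {d K : ℕ} (M : DataMarket d K)

theorem inner_x_x (hsub : M.Substitutes) {i j : Fin K} (hij : i ≠ j) :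
    inner ℝ (M.x i) (M.x j) = M.gam i * M.gam j := by
  have h := hsub i j hij
  simp only [inner_sub_left, inner_sub_right, real_inner_smul_left, real_inner_smul_right,
    real_inner_self_eq_norm_sq, M.norm_y, real_inner_comm (M.x j) M.y] at h
  have h1 : inner ℝ (M.x i) M.y = M.gam i := rfl
  have h2 : inner ℝ (M.x j) M.y = M.gam j := rfl
  rw [h1, h2] at h
  linarith

theorem gam_sq_le_one (i : Fin K) : M.gam i ^ 2 ≤ 1 := by
  have h := abs_real_inner_le_norm (M.x i) M.y
  rw [M.norm_x, M.norm_y, mul_one] at h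
  exact (sq_le_one_iff_abs_le_one _).2 h

theorem coe_noisyFunctional_signal (i : Fin K) :
    ⇑(noisyFunctional (M.x i) (Pi.single i 1) 0) = M.signal (d := d) i := by
  ext ω; simp [noisyFunctional_apply, signal, Pi.single_apply]

theorem coe_noisyFunctional_soldSignal (i : Fin K) (t : ℝ) :
    ⇑(noisyFunctional (M.x i) (Pi.single i 1) (Pi.single i t)) = M.soldSignal i t := by
  ext ω; simp [noisyFunctional_apply, signal, soldSignal, Pi.single_apply, add_assoc]

theorem coe_noisyFunctional_inner (u : EuclideanSpace ℝ (Fin d)) :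
    ⇑(noisyFunctional u (0 : Fin K → ℝ) 0) = fun ω => inner ℝ u ω.1 := by
  ext ω; simp [noisyFunctional_apply]

/-- The posterior mean of `⟪x i, θ⟫` given `s i` is `s i / 2`. -/
theorem serviceInfo_eq (i : Fin K) : M.serviceInfo i = 1 / 2 := by
  have hZT : cov[noisyFunctional (M.x i) 0 0, noisyFunctional (M.x i) (Pi.single i 1) 0;
      sampleLaw d K] = 1 := by
    simp [covariance_noisyFunctional, M.norm_x]
  have hTT : cov[noisyFunctional (M.x i) (Pi.single i 1) 0,
      noisyFunctional (M.x i) (Pi.single i 1) 0; sampleLaw d K] = 2 := by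
    simp [covariance_noisyFunctional, M.norm_x, Pi.single_apply]
    norm_num
  have h := revealedInfo_eq_of_residual_uncorrelated (sampleLaw d K) integral_dual_sampleLaw
    (noisyFunctional (M.x i) 0 0) (fun _ : Unit => noisyFunctional (M.x i) (Pi.single i 1) 0)
    (fun _ => 1 / 2) (by intro j; rw [hZT]; simp [hTT])
  rw [coe_noisyFunctional_inner, coe_noisyFunctional_signal] at h
  rw [coe_noisyFunctional_inner, coe_noisyFunctional_signal] at hZT
  simp only [iSup_const, hZT] at h
  rw [serviceInfo, h]
  simp

/-- The signal-to-noise ratio of the signal that platform `i` sells at noise level `t`: it equals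
`γ i * ⟪y, θ⟫` plus an independent term of variance `2 - γ i ^ 2 + t ^ 2`. -/
noncomputable def snr (i : Fin K) (t : ℝ≥0∞) : ℝ :=
  if t = ⊤ then 0 else M.gam i ^ 2 / (2 - M.gam i ^ 2 + t.toReal ^ 2)

theorem snr_top (i : Fin K) : M.snr i ⊤ = 0 := by simp [snr]

theorem snr_nonneg (i : Fin K) (t : ℝ≥0∞) : 0 ≤ M.snr i t := by
  unfold snr
  split_ifs
  · exact le_rfl
  · have := M.gam_sq_le_one i
    exact div_nonneg (sq_nonneg _) (by nlinarith [sq_nonneg t.toReal])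

theorem snr_le (i : Fin K) {t : ℝ≥0∞} (ht : t ≠ ⊤) : M.snr i t ≤ 1 / (1 + t.toReal ^ 2) := by
  have := M.gam_sq_le_one i
  rw [snr, if_neg ht]
  exact div_le_div₀ zero_le_one this (by positivity) (by linarith)

theorem snr_le_one (i : Fin K) (t : ℝ≥0∞) : M.snr i t ≤ 1 := by
  by_cases ht : t = ⊤
  · rw [ht, snr_top]; exact zero_le_one
  · refine (M.snr_le i ht).trans ?_
    rw [div_le_one (by positivity)]
    linarith [sq_nonneg t.toReal]

theorem snr_pos {i : Fin K} (hi : M.gam i ≠ 0) {t : ℝ≥0∞} (ht : t ≠ ⊤) : 0 < M.snr i t := by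
  have := M.gam_sq_le_one i
  rw [snr, if_neg ht]
  exact div_pos (by positivity) (by nlinarith [sq_nonneg t.toReal])

theorem snr_antitone (i : Fin K) {t t' : ℝ≥0∞} (h : t ≤ t') : M.snr i t' ≤ M.snr i t := by
  by_cases ht' : t' = ⊤
  · rw [ht', snr_top]; exact M.snr_nonneg i t
  · have ht : t ≠ ⊤ := ne_top_of_le_ne_top ht' h
    have := M.gam_sq_le_one i
    have h2 : t.toReal ≤ t'.toReal := ENNReal.toReal_mono ht' h
    have h3 : t.toReal ^ 2 ≤ t'.toReal ^ 2 := pow_le_pow_left₀ ENNReal.toReal_nonneg h2 2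
    rw [snr, snr, if_neg ht, if_neg ht']
    exact div_le_div_of_nonneg_left (sq_nonneg _) (by nlinarith [sq_nonneg t.toReal]) (by linarith)

end DataMarket

/-- The information about a standard Gaussian variable revealed by independent Gaussian
measurements of total signal-to-noise ratio `H`. -/
noncomputable def gaussianInfo (H : ℝ) : ℝ := H / (1 + H)

namespace DataMarket

variable {d K : ℕ} (M : DataMarket d K)

/-- Conditionally on `⟪y, θ⟫` the sold signals are independent, so that their signal-to-noise ratios
add up. -/
theorem leak_eq (hsub : M.Substitutes) (σ : Fin K → ℝ≥0∞) (S : Finset (Fin K)) :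
    M.leak σ S = gaussianInfo (∑ i ∈ S, M.snr i (σ i)) := by
  classical
  -- `χ` marks the platforms whose signals convey something to the buyer
  set χ : Fin K → ℝ := fun i => if i ∈ S ∧ σ i ≠ ⊤ then 1 else 0 with hχ
  set ν : Fin K → ℝ := fun i => 2 - M.gam i ^ 2 + (σ i).toReal ^ 2 with hν
  have hν0 : ∀ i, 0 < ν i := fun i => by
    have := M.gam_sq_le_one i
    simp only [hν]; nlinarith [sq_nonneg (σ i).toReal]
  have hχχ : ∀ i, χ i * χ i = χ i := fun i => by simp only [hχ]; split_ifs <;> simp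
  set H : ℝ := ∑ i ∈ S, M.snr i (σ i) with hH
  have hH0 : 0 ≤ H := Finset.sum_nonneg fun i _ => M.snr_nonneg i (σ i)
  have hHχ : H = ∑ i, χ i * (M.gam i ^ 2 / ν i) := by
    rw [hH, ← Finset.sum_filter_add_sum_filter_not Finset.univ (fun i => i ∈ S)
      (fun i => χ i * (M.gam i ^ 2 / ν i))]
    rw [Finset.sum_eq_zero (s := Finset.univ.filter fun i => ¬ i ∈ S), add_zero,
      Finset.filter_mem_eq_inter, Finset.univ_inter]
    · refine Finset.sum_congr rfl fun i hi => ?_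
      by_cases ht : σ i = ⊤ <;> simp [hχ, snr, ht, hi, hν]
    · intro i hi
      simp only [Finset.mem_filter] at hi
      simp [hχ, hi.2]
  set X : Fin K → StrongDual ℝ (SampleSpace d K) := fun i =>
    noisyFunctional (M.x i) (Pi.single i 1) (Pi.single i (σ i).toReal) with hX
  have hZX : ∀ j, cov[noisyFunctional M.y (0 : Fin K → ℝ) 0, X j; sampleLaw d K] = M.gam j := by
    intro j
    simp [hX, covariance_noisyFunctional, gam, real_inner_comm]
  have hXX : ∀ i j, cov[X i, X j; sampleLaw d K] =
      M.gam i * M.gam j + if i = j then ν j else 0 := by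
    intro i j
    rw [hX, covariance_noisyFunctional]
    split_ifs with h
    · subst h
      simp [M.norm_x, hν, Pi.single_apply]
      ring
    · rw [M.inner_x_x hsub h]
      simp [Pi.single_apply, Ne.symm h]
  have hZT : ∀ j, cov[noisyFunctional M.y (0 : Fin K → ℝ) 0, (χ j • X j : StrongDual ℝ _);
      sampleLaw d K] = χ j * M.gam j := fun j => by
    rw [← hZX, ← covariance_smul_right]; rfl
  have hTT : ∀ i j, cov[(χ i • X i : StrongDual ℝ _), (χ j • X j : StrongDual ℝ _);
      sampleLaw d K] = χ i * (χ j * (M.gam i * M.gam j + if i = j then ν j else 0)) := fun i j => by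
    rw [← hXX, ← covariance_smul_right, ← covariance_smul_left]; rfl
  have h := revealedInfo_eq_of_residual_uncorrelated (sampleLaw d K) integral_dual_sampleLaw
    (noisyFunctional M.y 0 0) (fun i => χ i • X i) (fun i => M.gam i / ν i / (1 + H)) (by
      intro j
      simp only [hZT, hTT]
      have e : ∀ i, M.gam i / ν i / (1 + H) *
          (χ i * (χ j * (M.gam i * M.gam j + if i = j then ν j else 0))) =
          χ j * M.gam j / (1 + H) * (χ i * (M.gam i ^ 2 / ν i)) +
            if i = j then χ j * M.gam j / (1 + H) else 0 := by
        intro i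
        split_ifs with hij
        · subst hij
          have := hν0 i
          field_simp
          linear_combination (ν i * M.gam i) * hχχ i
        · have := hν0 i
          field_simp
          ring
      rw [Finset.sum_congr rfl fun i _ => e i, Finset.sum_add_distrib, ← Finset.mul_sum, ← hHχ]
      simp only [Finset.sum_ite_eq', Finset.mem_univ, if_true]
      field_simp
      ring)
  have hobs : M.buyerObs σ S =
      ⨆ i, MeasurableSpace.comap (χ i • X i : StrongDual ℝ (SampleSpace d K)) (borel ℝ) := by
    have hcomap : MeasurableSpace.comap (0 : SampleSpace d K → ℝ) (borel ℝ) = ⊥ :=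
      MeasurableSpace.comap_const 0
    refine iSup_congr fun i => ?_
    by_cases hi : i ∈ S <;> by_cases ht : σ i = ⊤ <;>
      simp [hχ, hi, ht, hX, coe_noisyFunctional_soldSignal, hcomap]
  rw [← hobs, coe_noisyFunctional_inner] at h
  rw [leak, h]
  simp only [coe_noisyFunctional_inner] at hZT
  simp only [hZT]
  rw [gaussianInfo, hHχ, Finset.sum_div]
  rw [← hHχ]
  refine Finset.sum_congr rfl fun i _ => ?_
  ring

end DataMarket

/-! ### Concavity of the information -/

theorem gaussianInfo_zero : gaussianInfo 0 = 0 := by simp [gaussianInfo]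

theorem gaussianInfo_sub_gaussianInfo {x y : ℝ} (hx : 0 ≤ x) (hy : 0 ≤ y) :
    gaussianInfo y - gaussianInfo x = (y - x) / ((1 + x) * (1 + y)) := by
  unfold gaussianInfo
  field_simp
  ring

theorem gaussianInfo_mono {x y : ℝ} (hx : 0 ≤ x) (hxy : x ≤ y) :
    gaussianInfo x ≤ gaussianInfo y := by
  rw [← sub_nonneg, gaussianInfo_sub_gaussianInfo hx (hx.trans hxy)]
  exact div_nonneg (sub_nonneg.2 hxy) (by have := hx.trans hxy; positivity)

theorem gaussianInfo_lt {x y : ℝ} (hx : 0 ≤ x) (hxy : x < y) :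
    gaussianInfo x < gaussianInfo y := by
  rw [← sub_pos, gaussianInfo_sub_gaussianInfo hx (hx.trans hxy.le)]
  exact div_pos (sub_pos.2 hxy) (by have := hx.trans hxy.le; positivity)

theorem gaussianInfo_nonneg {x : ℝ} (hx : 0 ≤ x) : 0 ≤ gaussianInfo x :=
  div_nonneg hx (by linarith)

theorem gaussianInfo_le_one {x : ℝ} (hx : 0 ≤ x) : gaussianInfo x ≤ 1 :=
  div_le_one_of_le₀ (by linarith) (by linarith)

theorem gaussianInfo_sub_le {x y : ℝ} (hx : 0 ≤ x) (hxy : x ≤ y) :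
    gaussianInfo y - gaussianInfo x ≤ y - x := by
  rw [gaussianInfo_sub_gaussianInfo hx (hx.trans hxy)]
  exact div_le_self (sub_nonneg.2 hxy) (by nlinarith)

theorem gaussianInfo_increment_antitone {x y h : ℝ} (hx : 0 ≤ x) (hxy : x ≤ y) (hh : 0 ≤ h) :
    gaussianInfo (y + h) - gaussianInfo y ≤ gaussianInfo (x + h) - gaussianInfo x := by
  have hy := hx.trans hxy
  rw [gaussianInfo_sub_gaussianInfo hy (by linarith),
    gaussianInfo_sub_gaussianInfo hx (by linarith), add_sub_cancel_left, add_sub_cancel_left]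
  exact div_le_div_of_nonneg_left hh (by positivity)
    (mul_le_mul (by linarith) (by linarith) (by linarith) (by linarith))

theorem sum_marginal_gaussianInfo_le {ι : Type*} {h : ι → ℝ} (hh : ∀ i, 0 ≤ h i) (X : ℝ)
    (D : Finset ι) (hD : ∑ i ∈ D, h i ≤ X) :
    ∑ i ∈ D, (gaussianInfo X - gaussianInfo (X - h i)) ≤
      gaussianInfo X - gaussianInfo (X - ∑ i ∈ D, h i) := by
  classical
  induction D using Finset.induction_on with
  | empty => simp
  | insert j D hj ih =>
    rw [Finset.sum_insert hj] at hD
    rw [Finset.sum_insert hj, Finset.sum_insert hj]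
    have h1 := ih (by linarith [hh j])
    have hS : 0 ≤ ∑ i ∈ D, h i := Finset.sum_nonneg fun i _ => hh i
    have h2 := gaussianInfo_increment_antitone (x := X - (h j + ∑ i ∈ D, h i)) (y := X - h j)
      (h := h j) (by linarith) (by linarith) (hh j)
    rw [show X - h j + h j = X by ring,
      show X - (h j + ∑ i ∈ D, h i) + h j = X - ∑ i ∈ D, h i by ring] at h2
    linarith

/-! ### The pricing subgame -/

section Pricing

variable {ι : Type*} [DecidableEq ι]

/-- The value to the buyer of the data of seller `i` on top of those of the other sellers in `A`. -/
noncomputable def marginalValue (β : ℝ) (h : ι → ℝ) (A : Finset ι) (i : ι) : ℝ :=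
  β * (gaussianInfo (∑ j ∈ A, h j) - gaussianInfo (∑ j ∈ A.erase i, h j))

variable {β : ℝ} {h : ι → ℝ}

theorem sum_erase_le_sum (hh : ∀ i, 0 ≤ h i) (A : Finset ι) (i : ι) :
    ∑ j ∈ A.erase i, h j ≤ ∑ j ∈ A, h j :=
  Finset.sum_le_sum_of_subset_of_nonneg (Finset.erase_subset _ _) fun i _ _ => hh i

theorem marginalValue_nonneg (hβ : 0 ≤ β) (hh : ∀ i, 0 ≤ h i) (A : Finset ι) (i : ι) :
    0 ≤ marginalValue β h A i :=
  mul_nonneg hβ (sub_nonneg.2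
    (gaussianInfo_mono (Finset.sum_nonneg fun i _ => hh i) (sum_erase_le_sum hh A i)))

theorem marginalValue_le (hβ : 0 ≤ β) (hh : ∀ i, 0 ≤ h i) (A : Finset ι) (i : ι) :
    marginalValue β h A i ≤ β := by
  refine mul_le_of_le_one_right hβ ?_
  have h1 := gaussianInfo_le_one (Finset.sum_nonneg fun i (_ : i ∈ A) => hh i)
  have h2 := gaussianInfo_nonneg (Finset.sum_nonneg fun j (_ : j ∈ A.erase i) => hh j)
  linarith

/-- In every equilibrium of the pricing subgame between the sellers `A` the buyer ends up with all
the data that convey something, and every seller earns its marginal value.  At a lower price a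
seller is bought from whatever the others offer, since data are substitutes; at a higher price the
buyer, holding everything else, would rather do without it. -/
theorem pricing_outcome (hβ : 0 ≤ β) (hh : ∀ i, 0 ≤ h i) (A : Finset ι) (p : ι → ℝ)
    (buy : (ι → ℝ) → Finset ι)
    (hbuy : ∀ p b, β * gaussianInfo (∑ j ∈ A ∩ b, h j) - ∑ j ∈ A ∩ b, p j ≤
      β * gaussianInfo (∑ j ∈ A ∩ buy p, h j) - ∑ j ∈ A ∩ buy p, p j)
    (hprice : ∀ i ∈ A, ∀ q, (if i ∈ buy (Function.update p i q) then q else 0) ≤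
      if i ∈ buy p then p i else 0)
    (htie : β = 0 → A ⊆ buy p) :
    ∑ j ∈ A ∩ buy p, h j = ∑ j ∈ A, h j ∧
      ∀ i ∈ A, (if i ∈ buy p then p i else 0) = marginalValue β h A i := by
  have hsum0 : ∀ S : Finset ι, 0 ≤ ∑ j ∈ S, h j := fun S => Finset.sum_nonneg fun i _ => hh i
  have hlow : ∀ i ∈ A, marginalValue β h A i ≤ if i ∈ buy p then p i else 0 := by
    intro i hi
    refine le_of_forall_lt fun q hq => ?_
    -- a price strictly between `q` and the marginal value is accepted and beats `q`
    obtain ⟨r, hqr, hr⟩ := exists_between hq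
    refine hqr.trans_le ?_
    have hmem : i ∈ buy (Function.update p i r) := by
      by_contra hni
      set p' := Function.update p i r with hp'
      have hniC : i ∉ A ∩ buy p' := fun hc => hni (Finset.mem_inter.1 hc).2
      have h1 := hbuy p' (insert i (buy p'))
      rw [Finset.inter_insert_of_mem hi, Finset.sum_insert hniC, Finset.sum_insert hniC] at h1
      have hr' : p' i = r := by simp [hp']
      rw [hr'] at h1
      have h2 := gaussianInfo_increment_antitone (hsum0 (A ∩ buy p'))
        (y := ∑ j ∈ A.erase i, h j) (h := h i)
        (Finset.sum_le_sum_of_subset_of_nonneg (fun j hj => Finset.mem_erase.2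
          ⟨fun hji => hniC (hji ▸ hj), (Finset.mem_inter.1 hj).1⟩) fun i _ _ => hh i) (hh i)
      rw [Finset.sum_erase_add _ _ hi] at h2
      have h3 := mul_le_mul_of_nonneg_left h2 hβ
      rw [marginalValue] at hr
      rw [add_comm (h i)] at h1
      linarith
    have := hprice i hi r
    rwa [if_pos hmem] at this
  have hsum : ∑ j ∈ A ∩ buy p, h j = ∑ j ∈ A, h j := by
    rcases hβ.eq_or_lt with h0 | hpos
    · rw [Finset.inter_eq_left.2 (htie h0.symm)]
    · refine Finset.sum_subset Finset.inter_subset_left fun i hi hni => ?_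
      have hnb : i ∉ buy p := fun hb => hni (Finset.mem_inter.2 ⟨hi, hb⟩)
      have h1 := hlow i hi
      rw [if_neg hnb] at h1
      by_contra hne
      have h2 := gaussianInfo_lt (hsum0 (A.erase i)) (y := ∑ j ∈ A, h j) (by
        rw [← Finset.sum_erase_add _ _ hi]
        exact lt_add_of_pos_right _ (lt_of_le_of_ne (hh i) (Ne.symm hne)))
      exact absurd h1 (not_le.2 (mul_pos hpos (sub_pos.2 h2)))
  refine ⟨hsum, fun i hi => le_antisymm ?_ (hlow i hi)⟩
  split_ifs with hb
  · have hiB : i ∈ A ∩ buy p := Finset.mem_inter.2 ⟨hi, hb⟩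
    have h1 := hbuy p ((buy p).erase i)
    rw [Finset.inter_erase, hsum] at h1
    have h2 := Finset.sum_erase_add (A ∩ buy p) p hiB
    have h3 := Finset.sum_erase_add (A ∩ buy p) h hiB
    have h4 := Finset.sum_erase_add A h hi
    have h5 : ∑ j ∈ (A ∩ buy p).erase i, h j = ∑ j ∈ A.erase i, h j := by linarith
    rw [h5] at h1
    rw [marginalValue]
    linarith
  · exact marginalValue_nonneg hβ hh A i

/-- When every price is the marginal value, the buyer optimally buys everything. -/
theorem buyAll_optimal (hβ : 0 ≤ β) (hh : ∀ i, 0 ≤ h i) {A B : Finset ι} (hBA : B ⊆ A) :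
    β * gaussianInfo (∑ j ∈ B, h j) - ∑ j ∈ B, marginalValue β h A j ≤
      β * gaussianInfo (∑ j ∈ A, h j) - ∑ j ∈ A, marginalValue β h A j := by
  have h1 := Finset.sum_sdiff (f := h) hBA
  have h2 := Finset.sum_sdiff (f := marginalValue β h A) hBA
  have hB : 0 ≤ ∑ j ∈ B, h j := Finset.sum_nonneg fun i _ => hh i
  have h3 := mul_le_mul_of_nonneg_left
    (sum_marginal_gaussianInfo_le hh (∑ j ∈ A, h j) (A \ B) (by linarith)) hβ
  rw [show ∑ j ∈ A, h j - ∑ j ∈ A \ B, h j = ∑ j ∈ B, h j by linarith, Finset.mul_sum] at h3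
  have h4 : ∑ j ∈ A \ B, marginalValue β h A j =
      ∑ j ∈ A \ B, β * (gaussianInfo (∑ j ∈ A, h j) - gaussianInfo (∑ j ∈ A, h j - h j)) := by
    refine Finset.sum_congr rfl fun i hi => ?_
    have := Finset.sum_erase_add A h (Finset.mem_sdiff.1 hi).1
    rw [marginalValue, show ∑ j ∈ A.erase i, h j = ∑ j ∈ A, h j - h i by linarith]
  rw [← h4] at h3
  linarith

/-- No seller gains by deviating from marginal-value pricing: a buyer who still buys from a seller
with price `q` pays at most the seller's marginal value. -/
theorem le_marginalValue_of_bought (hβ : 0 ≤ β) (hh : ∀ i, 0 ≤ h i) {A B : Finset ι} (hBA : B ⊆ A)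
    {i : ι} (hiB : i ∈ B) (q : ℝ)
    (hopt : β * gaussianInfo (∑ j ∈ A.erase i, h j) -
        ∑ j ∈ A.erase i, Function.update (marginalValue β h A) i q j ≤
      β * gaussianInfo (∑ j ∈ B, h j) - ∑ j ∈ B, Function.update (marginalValue β h A) i q j) :
    q ≤ marginalValue β h A i := by
  have h1 := buyAll_optimal hβ hh hBA
  have h2 := Finset.sum_erase_add A (marginalValue β h A) (hBA hiB)
  have h3 := Finset.sum_erase_add B (marginalValue β h A) hiB
  have h4 := Finset.sum_erase_add B (Function.update (marginalValue β h A) i q) hiB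
  have h5 : ∀ S : Finset ι, ∑ j ∈ S.erase i, Function.update (marginalValue β h A) i q j =
      ∑ j ∈ S.erase i, marginalValue β h A j := fun S =>
    Finset.sum_congr rfl fun j hj => Function.update_of_ne (Finset.ne_of_mem_erase hj) _ _
  rw [h5] at hopt h4
  rw [Function.update_self] at h4
  have h6 : marginalValue β h A i = β * gaussianInfo (∑ j ∈ A, h j) -
    β * gaussianInfo (∑ j ∈ A.erase i, h j) := by rw [marginalValue]; ring
  linarith

end Pricing

/-! ### The user's sharing decision -/

section Sharing

variable {ι : Type*} [DecidableEq ι]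

/-- The user's utility from sharing with the entered platforms `A` when all their data are sold. -/
noncomputable def sharingValue (α : ℝ) (h : ι → ℝ) (A : Finset ι) : ℝ :=
  (A.card : ℝ) / 2 - α * gaussianInfo (∑ j ∈ A, h j)

variable {α : ℝ} {h : ι → ℝ}

theorem sharingValue_supermodular (hα : 0 ≤ α) (hh : ∀ i, 0 ≤ h i) (A B : Finset ι) :
    sharingValue α h A + sharingValue α h B ≤
      sharingValue α h (A ∪ B) + sharingValue α h (A ∩ B) := by
  have hc : ((A ∪ B).card : ℝ) + (A ∩ B).card = A.card + B.card := by
    exact_mod_cast Finset.card_union_add_card_inter A B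
  have h1 : ∑ j ∈ A ∪ B, h j = ∑ j ∈ A, h j + ∑ j ∈ B \ A, h j := by
    rw [← Finset.union_sdiff_self_eq_union, Finset.sum_union Finset.disjoint_sdiff]
  have h2 : ∑ j ∈ B, h j = ∑ j ∈ A ∩ B, h j + ∑ j ∈ B \ A, h j := by
    rw [← Finset.sum_inter_add_sum_sdiff B A, Finset.inter_comm]
  have h3 := mul_le_mul_of_nonneg_left (gaussianInfo_increment_antitone
    (Finset.sum_nonneg fun i (_ : i ∈ A ∩ B) => hh i) (y := ∑ j ∈ A, h j)
    (Finset.sum_le_sum_of_subset_of_nonneg Finset.inter_subset_left fun i _ _ => hh i)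
    (Finset.sum_nonneg fun i (_ : i ∈ B \ A) => hh i)) hα
  rw [← h1, ← h2] at h3
  unfold sharingValue
  linarith

/-- A platform whose data are noisy enough is worth sharing with, whatever else is shared. -/
theorem sharingValue_lt_insert (hα : 0 ≤ α) (hh : ∀ i, 0 ≤ h i) {A : Finset ι} {i : ι}
    (hi : i ∉ A) (hsmall : α * h i < 1 / 2) :
    sharingValue α h A < sharingValue α h (insert i A) := by
  have h0 : 0 ≤ ∑ j ∈ A, h j := Finset.sum_nonneg fun i _ => hh i
  have h1 := mul_le_mul_of_nonneg_left
    (gaussianInfo_sub_le h0 (y := h i + ∑ j ∈ A, h j) (by linarith [hh i])) hα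
  rw [sharingValue, sharingValue, Finset.card_insert_of_notMem hi, Finset.sum_insert hi]
  push_cast
  linarith

end Sharing

/-! ### Play after the first stage -/

namespace DataMarket

variable {d K : ℕ} (M : DataMarket d K)

/-- The signal-to-noise ratios of the sold signals under the noise levels `σ`. -/
noncomputable def snrs (σ : Fin K → ℝ≥0∞) (i : Fin K) : ℝ := M.snr i (σ i)

theorem snrs_nonneg (σ : Fin K → ℝ≥0∞) (i : Fin K) : 0 ≤ M.snrs σ i := M.snr_nonneg i (σ i)

theorem leak_eq_snrs (hsub : M.Substitutes) (σ : Fin K → ℝ≥0∞) (S : Finset (Fin K)) :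
    M.leak σ S = gaussianInfo (∑ i ∈ S, M.snrs σ i) := M.leak_eq hsub σ S

/-- Optimality of a strategy profile in all stages after the first one, that is, subgame perfect
equilibrium but for the platforms' noise levels and entry decisions. -/
structure IsContinuation (α β : ℝ) (m : Fin K → ℝ≥0∞) (s : StrategyProfile K) : Prop where
  buyer_opt : ∀ σ, MandateFeasible m σ → ∀ e a p b,
    M.buyerUtility β σ e a p b ≤ M.buyerUtility β σ e a p (s.buy σ e a p)
  price_opt : ∀ σ, MandateFeasible m σ → ∀ e a i (q : ℝ),
    M.platformUtility i e a (Function.update (s.price σ e a) i q)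
        (s.buy σ e a (Function.update (s.price σ e a) i q)) ≤
      M.platformUtility i e a (s.price σ e a) (s.buyAfter σ e a)
  buyer_tie : β = 0 → ∀ σ, MandateFeasible m σ → ∀ e a, e ∩ a ⊆ s.buyAfter σ e a
  user_opt : ∀ σ, MandateFeasible m σ → ∀ e,
    IsGreatest {a | ∀ a', M.userUtility α σ e a' (s.buyAfter σ e a') ≤
      M.userUtility α σ e a (s.buyAfter σ e a)} (s.share σ e)

/-- The utility of platform `i` from the first-stage decisions `(σ, e)`. -/
noncomputable def firstStageUtility (s : StrategyProfile K) (i : Fin K) (σ : Fin K → ℝ≥0∞)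
    (e : Finset (Fin K)) : ℝ :=
  M.platformUtility i e (s.share σ e) (s.priceAfter σ e) (s.buyAfter σ e (s.share σ e))

variable {M} {α β : ℝ} {m : Fin K → ℝ≥0∞} {s : StrategyProfile K}

theorem IsEquilibrium.isContinuation (h : M.IsEquilibrium α β m s) : M.IsContinuation α β m s :=
  ⟨h.buyer_opt, h.price_opt, h.buyer_tie, h.user_opt⟩

theorem IsEquilibrium.firstStage_opt (h : M.IsEquilibrium α β m s) (i : Fin K)
    (σ : Fin K → ℝ≥0∞) (e : Finset (Fin K)) (hσ : MandateFeasible m σ)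
    (hj : ∀ j, j ≠ i → σ j = s.noise j ∧ (j ∈ e ↔ j ∈ s.entry)) :
    M.firstStageUtility s i σ e ≤ M.firstStageUtility s i s.noise s.entry :=
  h.platform_opt i σ e hσ hj

theorem userUtility_eq (hsub : M.Substitutes) (σ : Fin K → ℝ≥0∞) (e a b : Finset (Fin K)) :
    M.userUtility α σ e a b =
      ((e ∩ a).card : ℝ) / 2 - α * gaussianInfo (∑ i ∈ e ∩ a ∩ b, M.snrs σ i) := by
  rw [userUtility, leak_eq_snrs M hsub]
  simp only [serviceInfo_eq, Finset.sum_const, nsmul_eq_mul]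
  ring

theorem platformUtility_eq {i : Fin K} {e a : Finset (Fin K)} (hi : i ∈ e ∩ a) (p : Fin K → ℝ)
    (b : Finset (Fin K)) :
    M.platformUtility i e a p b = 1 / 2 + (if i ∈ b then p i else 0) - M.c i := by
  obtain ⟨hie, hia⟩ := Finset.mem_inter.1 hi
  rw [platformUtility, if_pos hie, if_pos hia, serviceInfo_eq]
  by_cases hb : i ∈ b <;> simp [hia, hb]

/-- `pricing_outcome` in the market: on the path of every pricing subgame the buyer learns as much as
from all the data on offer, and revenues are marginal values. -/
theorem IsContinuation.pricing (h : M.IsContinuation α β m s) (hsub : M.Substitutes) (hβ : 0 ≤ β)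
    {σ : Fin K → ℝ≥0∞} (hσ : MandateFeasible m σ) (e a : Finset (Fin K)) :
    ∑ j ∈ e ∩ a ∩ s.buyAfter σ e a, M.snrs σ j = ∑ j ∈ e ∩ a, M.snrs σ j ∧
      ∀ i ∈ e ∩ a, (if i ∈ s.buyAfter σ e a then s.price σ e a i else 0) =
        marginalValue β (M.snrs σ) (e ∩ a) i := by
  refine pricing_outcome hβ (M.snrs_nonneg σ) (e ∩ a) (s.price σ e a) (s.buy σ e a) ?_ ?_ ?_
  · intro p b
    have := h.buyer_opt σ hσ e a p b
    rwa [buyerUtility, buyerUtility, leak_eq_snrs M hsub, leak_eq_snrs M hsub] at this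
  · intro i hi q
    have := h.price_opt σ hσ e a i q
    rw [platformUtility_eq hi, platformUtility_eq hi, Function.update_self] at this
    exact (add_le_add_iff_left _).1 ((sub_le_sub_iff_right _).1 this)
  · intro h0
    exact h.buyer_tie h0 σ hσ e a

theorem IsContinuation.userUtility_eq (h : M.IsContinuation α β m s) (hsub : M.Substitutes)
    (hβ : 0 ≤ β) {σ : Fin K → ℝ≥0∞} (hσ : MandateFeasible m σ) (e a : Finset (Fin K)) :
    M.userUtility α σ e a (s.buyAfter σ e a) = sharingValue α (M.snrs σ) (e ∩ a) := by
  rw [DataMarket.userUtility_eq hsub, (h.pricing hsub hβ hσ e a).1, sharingValue]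

theorem IsContinuation.firstStageUtility_eq (h : M.IsContinuation α β m s) (hsub : M.Substitutes)
    (hβ : 0 ≤ β) {σ : Fin K → ℝ≥0∞} (hσ : MandateFeasible m σ) (i : Fin K) (e : Finset (Fin K)) :
    M.firstStageUtility s i σ e =
      if i ∈ e then
        (if i ∈ s.share σ e then 1 / 2 + marginalValue β (M.snrs σ) (e ∩ s.share σ e) i else 0)
          - M.c i
      else 0 := by
  rw [firstStageUtility]
  by_cases he : i ∈ e
  · by_cases ha : i ∈ s.share σ e
    · have hA : i ∈ e ∩ s.share σ e := Finset.mem_inter.2 ⟨he, ha⟩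
      rw [platformUtility_eq hA, if_pos he, if_pos ha,
        ← (h.pricing hsub hβ hσ e (s.share σ e)).2 i hA, StrategyProfile.priceAfter]
    · simp [platformUtility, he, ha]
  · simp [platformUtility, he]

theorem IsContinuation.mem_share (h : M.IsContinuation α β m s) (hsub : M.Substitutes)
    (hβ : 0 ≤ β) (hα : 0 ≤ α) {σ : Fin K → ℝ≥0∞} (hσ : MandateFeasible m σ) {i : Fin K}
    {e : Finset (Fin K)} (hi : i ∈ e) (hsmall : α * M.snrs σ i < 1 / 2) : i ∈ s.share σ e := by
  by_contra hni
  have h1 := (h.user_opt σ hσ e).1 (insert i (s.share σ e))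
  rw [h.userUtility_eq hsub hβ hσ, h.userUtility_eq hsub hβ hσ, Finset.inter_insert_of_mem hi] at h1
  exact absurd h1 (not_le.2 (sharingValue_lt_insert hα (M.snrs_nonneg σ)
    (fun hc => hni (Finset.mem_inter.1 hc).2) hsmall))

theorem IsContinuation.userPayoff_eq (h : M.IsContinuation α β m s) (hsub : M.Substitutes)
    (hβ : 0 ≤ β) (hσ : MandateFeasible m s.noise) :
    M.userPayoff α s = sharingValue α (M.snrs s.noise) (s.entry ∩ s.share s.noise s.entry) :=
  h.userUtility_eq hsub hβ hσ _ _

/-! ### The privacy weight -/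

variable (M) in
/-- The standing assumption applied to the entry of a single platform. -/
theorem AsksForPrivacy.singleton (hsub : M.Substitutes) (hα : M.AsksForPrivacy α) (i : Fin K) :
    0 < α ∧ M.gam i ≠ 0 := by
  have hlt : 1 / 2 - α * gaussianInfo (M.snrs 0 i) < 0 := by
    by_contra hle
    rw [not_lt] at hle
    have := hα {i} {i} (by
      intro a'
      rw [userUtility_eq hsub, userUtility_eq hsub]
      by_cases ha : i ∈ a'
      · rw [Finset.singleton_inter_of_mem ha, Finset.inter_self]
      · rw [Finset.singleton_inter_of_notMem ha]
        simpa [gaussianInfo_zero] using hle)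
    simp at this
  have hg := gaussianInfo_nonneg (M.snrs_nonneg 0 i)
  refine ⟨?_, fun h0 => ?_⟩
  · by_contra hα0
    have := mul_nonpos_of_nonpos_of_nonneg (not_lt.1 hα0) hg
    linarith
  · have : M.snrs 0 i = 0 := by simp [snrs, snr, h0]
    rw [this, gaussianInfo_zero] at hlt
    norm_num at hlt

theorem AsksForPrivacy.mul_gaussianInfo_nonneg (hsub : M.Substitutes) (hα : M.AsksForPrivacy α)
    (σ : Fin K → ℝ≥0∞) (A : Finset (Fin K)) :
    0 ≤ α * gaussianInfo (∑ i ∈ A, M.snrs σ i) := by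
  rcases A.eq_empty_or_nonempty with rfl | ⟨i, _⟩
  · simp [gaussianInfo_zero]
  · exact mul_nonneg (hα.singleton M hsub i).1.le
      (gaussianInfo_nonneg (Finset.sum_nonneg fun i _ => M.snrs_nonneg σ i))

variable (M) in
/-- The noise level `√(2 α K)` is so high that the privacy loss from all platforms together weighs
less than the service of one of them. -/
theorem AsksForPrivacy.exists_noise (hsub : M.Substitutes) (hα : M.AsksForPrivacy α) :
    ∃ t : ℝ≥0, ∀ i : Fin K, ∀ τ : ℝ≥0∞, (t : ℝ≥0∞) ≤ τ → α * K * M.snr i τ < 1 / 2 := by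
  refine ⟨NNReal.sqrt (Real.toNNReal (2 * α * K)), fun i τ hτ => ?_⟩
  have hα0 := (hα.singleton M hsub i).1
  have h1 := mul_le_mul_of_nonneg_left ((M.snr_antitone i hτ).trans (M.snr_le i ENNReal.coe_ne_top))
    (show 0 ≤ α * K by positivity)
  refine h1.trans_lt ?_
  have h2 : (NNReal.sqrt (Real.toNNReal (2 * α * K)) : ℝ) ^ 2 = 2 * α * K := by
    rw [← NNReal.coe_pow, NNReal.sq_sqrt, Real.coe_toNNReal _ (by positivity)]
  rw [ENNReal.coe_toReal, h2, mul_one_div, div_lt_div_iff₀ (by positivity) (by norm_num)]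
  linarith

/-- Already the privacy loss from a single platform at the high noise level is worth the service. -/
theorem small_of_noise {t : ℝ≥0}
    (ht : ∀ i : Fin K, ∀ τ : ℝ≥0∞, (t : ℝ≥0∞) ≤ τ → α * K * M.snr i τ < 1 / 2) (hα : 0 ≤ α)
    {i : Fin K} {τ : ℝ≥0∞} (hτ : (t : ℝ≥0∞) ≤ τ) : α * M.snr i τ < 1 / 2 := by
  refine lt_of_le_of_lt ?_ (ht i τ hτ)
  have hK : (1 : ℝ) ≤ K := by exact_mod_cast i.pos
  have := mul_nonneg hα (M.snr_nonneg i τ)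
  nlinarith

/-! ### Entry of low-cost and high-cost platforms -/

theorem mandateFeasible_update {σ : Fin K → ℝ≥0∞} (hσ : MandateFeasible m σ) {i : Fin K}
    {τ : ℝ≥0∞} (h1 : m i ≤ τ) (h2 : m i ≠ ⊤ → τ ≠ ⊤) :
    MandateFeasible m (Function.update σ i τ) := by
  intro j
  by_cases hj : j = i
  · subst hj; rw [Function.update_self]; exact ⟨h1, h2⟩
  · rw [Function.update_of_ne hj]; exact hσ j

/-- Entering with a sufficiently noisy signal guarantees that the user shares, so that the utility
of a platform in equilibrium is at least that of being shared with and paid the marginal value. -/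
theorem IsEquilibrium.le_firstStageUtility (h : M.IsEquilibrium α β m s) (hsub : M.Substitutes)
    (hα : 0 ≤ α) (hβ : 0 ≤ β) {i : Fin K} {τ : ℝ≥0∞} (h1 : m i ≤ τ) (h2 : m i ≠ ⊤ → τ ≠ ⊤)
    (hsmall : α * M.snr i τ < 1 / 2) :
    ∃ A : Finset (Fin K), i ∈ A ∧ 1 / 2 +
      marginalValue β (M.snrs (Function.update s.noise i τ)) A i - M.c i ≤
        M.firstStageUtility s i s.noise s.entry := by
  have hσ := mandateFeasible_update h.feasible h1 h2
  have hi : i ∈ insert i s.entry := Finset.mem_insert_self i s.entry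
  have hsh := h.isContinuation.mem_share hsub hβ hα hσ hi (by
    simpa [snrs] using hsmall)
  have hdev := h.firstStage_opt i (Function.update s.noise i τ) (insert i s.entry) hσ
    fun j hj => ⟨Function.update_of_ne hj _ _, by simp [hj]⟩
  rw [h.isContinuation.firstStageUtility_eq hsub hβ hσ, if_pos hi, if_pos hsh] at hdev
  exact ⟨_, Finset.mem_inter.2 ⟨hi, hsh⟩, hdev⟩

theorem IsEquilibrium.mem_of_firstStageUtility_pos (h : M.IsEquilibrium α β m s)
    (hsub : M.Substitutes) (hβ : 0 ≤ β) {i : Fin K}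
    (hpos : 0 < M.firstStageUtility s i s.noise s.entry) :
    i ∈ s.entry ∧ i ∈ s.share s.noise s.entry := by
  rw [h.isContinuation.firstStageUtility_eq hsub hβ h.feasible] at hpos
  have := M.cost_nonneg i
  split_ifs at hpos with h1 h2
  · exact ⟨h1, h2⟩
  · linarith
  · exact absurd hpos (lt_irrefl 0)

theorem IsEquilibrium.lowCost_mem (h : M.IsEquilibrium α β m s) (hsub : M.Substitutes)
    (hα : M.AsksForPrivacy α) (hβ : 0 ≤ β) {i : Fin K} (hi : M.LowCost i) :
    i ∈ s.entry ∧ i ∈ s.share s.noise s.entry := by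
  obtain ⟨t, ht⟩ := hα.exists_noise M hsub
  have hα0 := (hα.singleton M hsub i).1.le
  obtain ⟨A, _, hA⟩ := h.le_firstStageUtility hsub hα0 hβ (i := i) (τ := max (m i) t)
    (le_max_left _ _) (fun hm => (max_lt hm.lt_top ENNReal.coe_lt_top).ne)
    (small_of_noise ht hα0 (le_max_right _ _))
  have h0 := marginalValue_nonneg hβ
    (M.snrs_nonneg (Function.update s.noise i (max (m i) (t : ℝ≥0∞)))) A i
  refine h.mem_of_firstStageUtility_pos hsub hβ ?_
  have : M.c i < 1 / 2 := hi
  linarith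

/-- A high-cost platform stays out when what it can earn from selling data falls short of its loss
on the service. -/
theorem IsEquilibrium.notMem_entry (h : M.IsEquilibrium α β m s) (hsub : M.Substitutes)
    (hβ : 0 ≤ β) {i : Fin K} (hi : M.HighCost i)
    (hrev : ∀ A, marginalValue β (M.snrs s.noise) A i < M.c i - 1 / 2) : i ∉ s.entry := by
  intro hmem
  have hdev := h.firstStage_opt i s.noise (s.entry.erase i) h.feasible
    fun j hj => ⟨rfl, by simp [hj]⟩
  rw [h.isContinuation.firstStageUtility_eq hsub hβ h.feasible,
    h.isContinuation.firstStageUtility_eq hsub hβ h.feasible,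
    if_neg (Finset.notMem_erase _ _), if_pos hmem] at hdev
  have h1 : 1 / 2 < M.c i := hi
  split_ifs at hdev with h2
  · have := hrev (s.entry ∩ s.share s.noise s.entry)
    linarith
  · linarith

open Classical in
variable (M) in
/-- The set of the low-cost platforms. -/
noncomputable def lowCostSet : Finset (Fin K) := Finset.univ.filter M.LowCost

theorem mem_lowCostSet {i : Fin K} : i ∈ M.lowCostSet ↔ M.LowCost i := by
  simp [lowCostSet]

theorem eq_top_of_ban {σ : Fin K → ℝ≥0∞} (hσ : MandateFeasible (dataBan K) σ) (i : Fin K) :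
    σ i = ⊤ := top_le_iff.1 (hσ i).1

theorem snrs_eq_zero_of_ban {σ : Fin K → ℝ≥0∞} (hσ : MandateFeasible (dataBan K) σ) (i : Fin K) :
    M.snrs σ i = 0 := by rw [snrs, eq_top_of_ban hσ, snr_top]

theorem marginalValue_of_ban {σ : Fin K → ℝ≥0∞} (hσ : MandateFeasible (dataBan K) σ)
    (A : Finset (Fin K)) (i : Fin K) : marginalValue β (M.snrs σ) A i = 0 := by
  simp [marginalValue, snrs_eq_zero_of_ban hσ]

/-- If exactly the low-cost platforms enter, the user shares with all of them. -/
theorem IsEquilibrium.userPayoff_of_entry (h : M.IsEquilibrium α β m s) (hsub : M.Substitutes)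
    (hα : M.AsksForPrivacy α) (hβ : 0 ≤ β) (he : ∀ i, i ∈ s.entry ↔ M.LowCost i) :
    M.userPayoff α s = sharingValue α (M.snrs s.noise) M.lowCostSet := by
  rw [h.isContinuation.userPayoff_eq hsub hβ h.feasible]
  congr 1
  ext i
  rw [Finset.mem_inter, mem_lowCostSet, he]
  exact ⟨fun h => h.1, fun hi => ⟨hi, (h.lowCost_mem hsub hα hβ hi).2⟩⟩

theorem IsEquilibrium.userPayoff_of_ban (h : M.IsEquilibrium α β (dataBan K) s)
    (hsub : M.Substitutes) (hcost : ∀ i, M.LowCost i ∨ M.HighCost i) (hα : M.AsksForPrivacy α)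
    (hβ : 0 ≤ β) : M.userPayoff α s = (M.lowCostSet.card : ℝ) / 2 := by
  have he : ∀ i, i ∈ s.entry ↔ M.LowCost i := fun i =>
    ⟨fun hi => (hcost i).resolve_right fun hh => h.notMem_entry hsub hβ hh
      (fun A => by rw [marginalValue_of_ban h.feasible]; exact sub_pos.2 hh) hi,
      fun hi => (h.lowCost_mem hsub hα hβ hi).1⟩
  rw [h.userPayoff_of_entry hsub hα hβ he, sharingValue]
  simp [snrs_eq_zero_of_ban h.feasible, gaussianInfo_zero]

/-- If exactly the low-cost platforms enter, the user is at best as well off as under the ban, since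
data sales only cost privacy. -/
theorem IsEquilibrium.userPayoff_le_ban (h : M.IsEquilibrium α β m s) (hsub : M.Substitutes)
    (hα : M.AsksForPrivacy α) (hβ : 0 ≤ β) (he : ∀ i, i ∈ s.entry ↔ M.LowCost i) :
    M.userPayoff α s ≤ (M.lowCostSet.card : ℝ) / 2 ∧
      ((∃ i, M.LowCost i ∧ m i ≠ ⊤) → M.userPayoff α s < (M.lowCostSet.card : ℝ) / 2) := by
  rw [h.userPayoff_of_entry hsub hα hβ he, sharingValue]
  refine ⟨by linarith [hα.mul_gaussianInfo_nonneg hsub s.noise M.lowCostSet], ?_⟩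
  rintro ⟨i, hi, hm⟩
  obtain ⟨hα0, hγ⟩ := hα.singleton M hsub i
  have hsum : 0 < ∑ j ∈ M.lowCostSet, M.snrs s.noise j :=
    Finset.sum_pos' (fun j _ => M.snrs_nonneg _ j)
      ⟨i, mem_lowCostSet.2 hi, M.snr_pos hγ ((h.feasible i).2 hm)⟩
  have := gaussianInfo_lt le_rfl hsum
  rw [gaussianInfo_zero] at this
  linarith [mul_pos hα0 this]

end DataMarket

/-! ### Existence of equilibria -/

namespace DataMarket

variable {d K : ℕ} {M : DataMarket d K} {α β : ℝ}

/-- By supermodularity the union of two optimal sharing profiles is optimal. -/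
theorem exists_isGreatest_sharing (hsub : M.Substitutes) (hα : M.AsksForPrivacy α)
    (σ : Fin K → ℝ≥0∞) (e : Finset (Fin K)) :
    ∃ a, IsGreatest {a | ∀ a', sharingValue α (M.snrs σ) (e ∩ a') ≤
      sharingValue α (M.snrs σ) (e ∩ a)} a := by
  set T : Set (Finset (Fin K)) := {a | ∀ a', sharingValue α (M.snrs σ) (e ∩ a') ≤
    sharingValue α (M.snrs σ) (e ∩ a)} with hT
  have hne : T.Nonempty := Finite.exists_max fun a => sharingValue α (M.snrs σ) (e ∩ a)
  have hunion : ∀ a ∈ T, ∀ b ∈ T, a ∪ b ∈ T := by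
    intro a ha b hb
    rcases isEmpty_or_nonempty (Fin K) with hK | ⟨⟨i⟩⟩
    · rwa [Subsingleton.elim (a ∪ b) a]
    · intro c
      have h1 := sharingValue_supermodular (hα.singleton M hsub i).1.le (M.snrs_nonneg σ)
        (e ∩ a) (e ∩ b)
      rw [← Finset.inter_union_distrib_left, ← Finset.inter_inter_distrib_left] at h1
      linarith [ha c, hb (a ∩ b)]
  obtain ⟨a, ha⟩ := (Set.toFinite T).exists_maximal hne
  exact ⟨a, ha.prop, fun b hb =>
    Finset.union_subset_left (ha.le_of_ge (hunion b hb a ha.prop) Finset.subset_union_right)⟩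

/-- Given any first-stage decisions there is a profile of strategies that plays optimally from the
second stage on: prices are marginal values, and the buyer buys everything if that is optimal. -/
theorem exists_isContinuation (hsub : M.Substitutes) (hα : M.AsksForPrivacy α) (hβ : 0 ≤ β)
    (noise : Fin K → ℝ≥0∞) (entry : Finset (Fin K)) :
    ∃ s : StrategyProfile K, s.noise = noise ∧ s.entry = entry ∧
      ∀ m, M.IsContinuation α β m s := by
  have hbuy : ∀ σ e a p, ∃ B, (∀ b, M.buyerUtility β σ e a p b ≤ M.buyerUtility β σ e a p B) ∧
      ((∀ b, M.buyerUtility β σ e a p b ≤ M.buyerUtility β σ e a p Finset.univ) →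
        B = Finset.univ) := by
    intro σ e a p
    by_cases h : ∀ b, M.buyerUtility β σ e a p b ≤ M.buyerUtility β σ e a p Finset.univ
    · exact ⟨Finset.univ, h, fun _ => rfl⟩
    · obtain ⟨B, hB⟩ := Finite.exists_max fun b => M.buyerUtility β σ e a p b
      exact ⟨B, hB, fun h' => absurd h' h⟩
  choose buy hopt huniv using hbuy
  choose share hshare using exists_isGreatest_sharing (M := M) hsub hα
  have hall : ∀ σ e a, buy σ e a (marginalValue β (M.snrs σ) (e ∩ a)) = Finset.univ := by
    intro σ e a
    refine huniv _ _ _ _ fun b => ?_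
    rw [buyerUtility, buyerUtility, leak_eq_snrs M hsub, leak_eq_snrs M hsub, Finset.inter_univ]
    exact buyAll_optimal hβ (M.snrs_nonneg σ) Finset.inter_subset_left
  refine ⟨⟨noise, entry, share, fun σ e a => marginalValue β (M.snrs σ) (e ∩ a), buy⟩, rfl, rfl,
    fun m => ⟨fun σ _ e a p b => hopt σ e a p b, ?_, ?_, ?_⟩⟩
  · intro σ _ e a i q
    by_cases hi : i ∈ e ∩ a
    · rw [platformUtility_eq hi, platformUtility_eq hi, Function.update_self]
      simp only [StrategyProfile.buyAfter, hall, Finset.mem_univ, if_true]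
      have : (if i ∈ buy σ e a (Function.update (marginalValue β (M.snrs σ) (e ∩ a)) i q)
          then q else 0) ≤ marginalValue β (M.snrs σ) (e ∩ a) i := by
        split_ifs with hb
        · have h := hopt σ e a (Function.update (marginalValue β (M.snrs σ) (e ∩ a)) i q)
            (Finset.univ.erase i)
          rw [buyerUtility, buyerUtility, leak_eq_snrs M hsub, leak_eq_snrs M hsub,
            Finset.inter_erase, Finset.inter_univ] at h
          exact le_marginalValue_of_bought hβ (M.snrs_nonneg σ) Finset.inter_subset_left
            (Finset.mem_inter.2 ⟨hi, hb⟩) q h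
        · exact marginalValue_nonneg hβ (M.snrs_nonneg σ) _ _
      linarith
    · -- a platform without data to sell earns nothing at any price
      by_cases he : i ∈ e
      · have ha : i ∉ a := fun ha => hi (Finset.mem_inter.2 ⟨he, ha⟩)
        simp [platformUtility, he, ha]
      · simp [platformUtility, he]
  · intro _ σ _ e a
    simp only [StrategyProfile.buyAfter, hall, Finset.subset_univ]
  · intro σ _ e
    simp only [StrategyProfile.buyAfter, hall, userUtility_eq hsub, Finset.inter_univ]
    exact hshare σ e

/-- Under the ban there is an equilibrium in which exactly the low-cost platforms enter. -/
theorem exists_isEquilibrium_ban (hsub : M.Substitutes)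
    (hcost : ∀ i, M.LowCost i ∨ M.HighCost i) (hα : M.AsksForPrivacy α) (hβ : 0 ≤ β) :
    ∃ s, M.IsEquilibrium α β (dataBan K) s := by
  obtain ⟨s, hn, he, hs⟩ := exists_isContinuation hsub hα hβ (dataBan K) M.lowCostSet
  have hs := hs (dataBan K)
  have hfeas : MandateFeasible (dataBan K) s.noise := by
    rw [hn]; exact fun i => ⟨le_rfl, fun h => h⟩
  have hpay : ∀ i σ e, MandateFeasible (dataBan K) σ →
      M.firstStageUtility s i σ e = if i ∈ e then 1 / 2 - M.c i else 0 := by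
    intro i σ e hσ
    rw [hs.firstStageUtility_eq hsub hβ hσ]
    refine if_ctx_congr Iff.rfl (fun hi => ?_) fun _ => rfl
    rw [if_pos (hs.mem_share hsub hβ (hα.singleton M hsub i).1.le hσ hi
      (by rw [snrs_eq_zero_of_ban hσ]; norm_num)), marginalValue_of_ban hσ, add_zero]
  refine ⟨s, hfeas, hs.buyer_opt, hs.price_opt, hs.buyer_tie, hs.user_opt, ?_⟩
  intro i σ e hσ _
  change M.firstStageUtility s i σ e ≤ M.firstStageUtility s i s.noise s.entry
  rw [hpay i σ e hσ, hpay i _ _ hfeas, he]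
  rcases hcost i with hi | hi
  · rw [if_pos (mem_lowCostSet.2 hi)]
    have : M.c i < 1 / 2 := hi
    split_ifs <;> linarith
  · have : 1 / 2 < M.c i := hi
    rw [if_neg fun h => absurd (mem_lowCostSet.1 h) (not_lt.2 this.le)]
    split_ifs <;> linarith

/-- A lower noise level increases a platform's marginal value. -/
theorem marginalValue_snrs_mono (hβ : 0 ≤ β) {σ σ' : Fin K → ℝ≥0∞} {i : Fin K}
    (hne : ∀ j, j ≠ i → σ' j = σ j) (hi : σ i ≤ σ' i) {A : Finset (Fin K)} (hA : i ∈ A) :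
    marginalValue β (M.snrs σ') A i ≤ marginalValue β (M.snrs σ) A i := by
  have h1 : ∑ j ∈ A.erase i, M.snrs σ' j = ∑ j ∈ A.erase i, M.snrs σ j :=
    Finset.sum_congr rfl fun j hj => by rw [snrs, snrs, hne j (Finset.ne_of_mem_erase hj)]
  rw [marginalValue, marginalValue, ← Finset.sum_erase_add A _ hA,
    ← Finset.sum_erase_add A (M.snrs σ) hA, h1]
  refine mul_le_mul_of_nonneg_left (sub_le_sub_right (gaussianInfo_mono ?_ ?_) _) hβ
  · exact add_nonneg (Finset.sum_nonneg fun j _ => M.snrs_nonneg σ j) (M.snrs_nonneg σ' i)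
  · exact add_le_add_right (M.snr_antitone i hi) _

/-- Every signal-to-noise ratio is at most `1`, which bounds the competition among sellers. -/
theorem le_marginalValue_snrs (hβ : 0 ≤ β) (σ : Fin K → ℝ≥0∞) {A : Finset (Fin K)} {i : Fin K}
    (hA : i ∈ A) :
    β * (M.snrs σ i / (1 + K) ^ 2) ≤ marginalValue β (M.snrs σ) A i := by
  have hsum := Finset.sum_erase_add A (M.snrs σ) hA
  have h0 : 0 ≤ ∑ j ∈ A.erase i, M.snrs σ j := Finset.sum_nonneg fun j _ => M.snrs_nonneg σ j
  have hi := M.snrs_nonneg σ i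
  have hK : ∑ j ∈ A, M.snrs σ j ≤ K := by
    refine (Finset.sum_le_card_nsmul A _ 1 fun j _ => M.snr_le_one j _).trans ?_
    rw [nsmul_eq_mul, mul_one]
    exact_mod_cast (Finset.card_le_univ A).trans_eq (Fintype.card_fin K)
  rw [marginalValue, gaussianInfo_sub_gaussianInfo h0 (by linarith)]
  refine mul_le_mul_of_nonneg_left ?_ hβ
  rw [show ∑ j ∈ A, M.snrs σ j - ∑ j ∈ A.erase i, M.snrs σ j = M.snrs σ i by linarith, sq]
  exact div_le_div_of_nonneg_left hi (by nlinarith)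
    (mul_le_mul (by linarith) (by linarith) (by linarith) (by positivity))

/-- If the uniform mandate is high enough for the user to share with everyone, and the buyer's
valuation is high enough for the sales to cover the costs, there is an equilibrium in which all
platforms enter at the lowest noise level allowed. -/
theorem exists_isEquilibrium_uniformMandate {t : ℝ≥0}
    (ht : ∀ i : Fin K, ∀ τ : ℝ≥0∞, (t : ℝ≥0∞) ≤ τ → α * K * M.snr i τ < 1 / 2)
    (hrev : ∀ i : Fin K, M.c i ≤ β * (M.snr i t / (1 + K) ^ 2))
    (hsub : M.Substitutes) (hα : M.AsksForPrivacy α) (hβ : 0 ≤ β) :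
    ∃ s, M.IsEquilibrium α β (uniformMandate K t) s := by
  obtain ⟨s, hn, he, hs⟩ := exists_isContinuation hsub hα hβ (uniformMandate K t) Finset.univ
  have hs := hs (uniformMandate K t)
  have hfeas : MandateFeasible (uniformMandate K t) s.noise := by
    rw [hn]; exact fun i => ⟨le_rfl, fun h => h⟩
  have hshare : ∀ i σ e, MandateFeasible (uniformMandate K t) σ → i ∈ e → i ∈ s.share σ e := by
    intro i σ e hσ hi
    have hα0 := (hα.singleton M hsub i).1.le
    exact hs.mem_share hsub hβ hα0 hσ hi (small_of_noise ht hα0 (hσ i).1)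
  have hpay : ∀ i σ e, MandateFeasible (uniformMandate K t) σ → M.firstStageUtility s i σ e =
      if i ∈ e then 1 / 2 + marginalValue β (M.snrs σ) e i - M.c i else 0 := by
    intro i σ e hσ
    rw [hs.firstStageUtility_eq hsub hβ hσ]
    refine if_ctx_congr Iff.rfl (fun hi => ?_) fun _ => rfl
    rw [if_pos (hshare i σ e hσ hi),
      Finset.inter_eq_left.2 fun j hj => hshare j σ e hσ hj]
  refine ⟨s, hfeas, hs.buyer_opt, hs.price_opt, hs.buyer_tie, hs.user_opt, ?_⟩
  intro i σ e hσ hj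
  change M.firstStageUtility s i σ e ≤ M.firstStageUtility s i s.noise s.entry
  rw [hpay i σ e hσ, hpay i _ _ hfeas, he, if_pos (Finset.mem_univ i)]
  have hmem : i ∈ (Finset.univ : Finset (Fin K)) := Finset.mem_univ i
  split_ifs with hi
  · have heu : e = Finset.univ := by
      refine Finset.eq_univ_of_forall fun j => ?_
      by_cases hji : j = i
      · exact hji ▸ hi
      · rw [(hj j hji).2, he]; exact Finset.mem_univ j
    rw [heu]
    have := marginalValue_snrs_mono (M := M) hβ (fun j hji => (hj j hji).1)
      (show s.noise i ≤ σ i by rw [hn]; exact (hσ i).1) hmem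
    linarith
  · have h1 := le_marginalValue_snrs (M := M) hβ s.noise hmem
    have h2 : M.snrs s.noise i = M.snr i t := by rw [snrs, hn]; rfl
    rw [h2] at h1
    linarith [hrev i]

/-- Under the same conditions all platforms enter in every equilibrium, and the loss of privacy is
smaller than the value of a single service. -/
theorem IsEquilibrium.entry_of_uniformMandate {t : ℝ≥0}
    (ht : ∀ i : Fin K, ∀ τ : ℝ≥0∞, (t : ℝ≥0∞) ≤ τ → α * K * M.snr i τ < 1 / 2)
    (hrev : ∀ i : Fin K, M.c i ≤ β * (M.snr i t / (1 + K) ^ 2)) {s : StrategyProfile K}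
    (h : M.IsEquilibrium α β (uniformMandate K t) s) (hsub : M.Substitutes)
    (hα : M.AsksForPrivacy α) (hβ : 0 ≤ β) :
    (∀ i, i ∈ s.entry) ∧ (0 < K → (K : ℝ) / 2 - 1 / 2 < M.userPayoff α s) := by
  have hmem : ∀ i, i ∈ s.entry ∧ i ∈ s.share s.noise s.entry := by
    intro i
    have hα0 := (hα.singleton M hsub i).1.le
    obtain ⟨A, hiA, hA⟩ := h.le_firstStageUtility hsub hα0 hβ (i := i) (τ := t) le_rfl
      (fun _ => ENNReal.coe_ne_top) (small_of_noise ht hα0 le_rfl)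
    have h1 := le_marginalValue_snrs (M := M) hβ (Function.update s.noise i t) hiA
    have h2 : M.snrs (Function.update s.noise i t) i = M.snr i t := by
      rw [snrs, Function.update_self]
    rw [h2] at h1
    exact h.mem_of_firstStageUtility_pos hsub hβ (by linarith [hrev i])
  refine ⟨fun i => (hmem i).1, fun hK => ?_⟩
  have huniv : s.entry ∩ s.share s.noise s.entry = Finset.univ :=
    Finset.eq_univ_of_forall fun i => Finset.mem_inter.2 (hmem i)
  rw [h.isContinuation.userPayoff_eq hsub hβ h.feasible, huniv, sharingValue, Finset.card_univ,
    Fintype.card_fin]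
  have hα0 := (hα.singleton M hsub ⟨0, hK⟩).1.le
  have hK' : (0 : ℝ) < K := by exact_mod_cast hK
  have h1 := gaussianInfo_sub_le le_rfl
    (Finset.sum_nonneg fun i (_ : i ∈ Finset.univ) => M.snrs_nonneg s.noise i)
  rw [gaussianInfo_zero, sub_zero, sub_zero] at h1
  have h2 : ∑ i, K * (α * M.snrs s.noise i) < ∑ _i : Fin K, (1 / 2 : ℝ) :=
    Finset.sum_lt_sum_of_nonempty ⟨⟨0, hK⟩, Finset.mem_univ _⟩ fun i _ => by
      have := ht i (s.noise i) (h.feasible i).1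
      rw [snrs]; linarith
  rw [← Finset.mul_sum, ← Finset.mul_sum, Finset.sum_const, Finset.card_univ, Fintype.card_fin,
    nsmul_eq_mul] at h2
  linarith [mul_le_mul_of_nonneg_left h1 hα0, lt_of_mul_lt_mul_left h2 hK'.le]

end DataMarket

/-! ### Bans and mandates compared -/

theorem proposition7 {d K : ℕ} (M : DataMarket d K) (hsub : M.Substitutes)
    (hcost : ∀ i, M.LowCost i ∨ M.HighCost i) (α : ℝ) (hα : M.AsksForPrivacy α) :
    -- all platforms are low-cost
    ((∀ i, M.LowCost i) → ∀ β : ℝ, 0 ≤ β →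
      (∃ s₀, M.IsEquilibrium α β (dataBan K) s₀) ∧
      ∀ m s, M.IsEquilibrium α β m s →
        (∀ i, i ∈ s.entry) ∧
        ∀ s₀, M.IsEquilibrium α β (dataBan K) s₀ →
          M.userPayoff α s ≤ M.userPayoff α s₀ ∧
          ((∃ i, m i ≠ ⊤) → M.userPayoff α s < M.userPayoff α s₀)) ∧
    -- some platform is high-cost
    ((∃ i, M.HighCost i) → ∃ (βtilde βlow : ℝ) (σbar : ℝ≥0), 0 < βlow ∧
      (∀ β : ℝ, 0 ≤ β → βtilde ≤ β →
        (∃ s₀, M.IsEquilibrium α β (dataBan K) s₀) ∧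
        (∃ s, M.IsEquilibrium α β (uniformMandate K σbar) s) ∧
        ∀ s, M.IsEquilibrium α β (uniformMandate K σbar) s →
          (∀ i, i ∈ s.entry) ∧
          ∀ s₀, M.IsEquilibrium α β (dataBan K) s₀ →
            M.userPayoff α s₀ < M.userPayoff α s) ∧
      (∀ β : ℝ, 0 ≤ β → β ≤ βlow →
        (∃ s₀, M.IsEquilibrium α β (dataBan K) s₀) ∧
        ∀ m s, M.IsEquilibrium α β m s →
          (∀ i, i ∈ s.entry ↔ M.LowCost i) ∧
          ∀ s₀, M.IsEquilibrium α β (dataBan K) s₀ →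
            M.userPayoff α s ≤ M.userPayoff α s₀ ∧
            ((∃ i, M.LowCost i ∧ m i ≠ ⊤) → M.userPayoff α s < M.userPayoff α s₀))) := by
  have hban : ∀ β : ℝ, 0 ≤ β → ∃ s₀, M.IsEquilibrium α β (dataBan K) s₀ := fun β hβ =>
    DataMarket.exists_isEquilibrium_ban hsub hcost hα hβ
  refine ⟨fun hlow β hβ => ⟨hban β hβ, fun m s h => ?_⟩, ?_⟩
  · have hentry : ∀ i, i ∈ s.entry := fun i => (h.lowCost_mem hsub hα hβ (hlow i)).1
    refine ⟨hentry, fun s₀ h₀ => ?_⟩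
    rw [h₀.userPayoff_of_ban hsub hcost hα hβ]
    obtain ⟨h1, h2⟩ := h.userPayoff_le_ban hsub hα hβ
      fun i => ⟨fun _ => hlow i, fun _ => hentry i⟩
    exact ⟨h1, fun ⟨i, hi⟩ => h2 ⟨i, hlow i, hi⟩⟩
  · rintro ⟨i₀, hi₀⟩
    obtain ⟨t, ht⟩ := hα.exists_noise M hsub
    have hK : 0 < K := i₀.pos
    have hsnr : ∀ i, 0 < M.snr i t := fun i =>
      M.snr_pos (hα.singleton M hsub i).2 ENNReal.coe_ne_top
    have hterm : ∀ i, 0 ≤ M.c i * ((1 + K) ^ 2 / M.snr i t) := fun i =>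
      mul_nonneg (M.cost_nonneg i) (div_nonneg (by positivity) (hsnr i).le)
    -- below `ε` the sales of no high-cost platform can cover its loss on the service
    obtain ⟨ε, hε, hεc⟩ : ∃ ε : ℝ, 0 < ε ∧ ∀ i, M.HighCost i → ε < M.c i - 1 / 2 := by
      have hne : (Finset.univ : Finset (Fin K)).Nonempty := ⟨i₀, Finset.mem_univ _⟩
      refine ⟨(Finset.univ.inf' hne fun i => |M.c i - 1 / 2|) / 2, half_pos ?_, fun i hi => ?_⟩
      · rw [Finset.lt_inf'_iff]
        intro i _
        refine abs_pos.2 (sub_ne_zero.2 ?_)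
        exact (hcost i).elim (fun h => ne_of_lt h) fun h => ne_of_gt h
      · have h1 := Finset.inf'_le (fun i => |M.c i - 1 / 2|) (Finset.mem_univ i)
        have h2 : 0 < M.c i - 1 / 2 := sub_pos.2 hi
        rw [abs_of_pos h2] at h1
        linarith
    refine ⟨∑ i, M.c i * ((1 + K) ^ 2 / M.snr i t), ε, t, hε, fun β hβ hβt => ?_,
      fun β hβ hβε => ⟨hban β hβ, fun m s h => ?_⟩⟩
    · have hrev : ∀ i, M.c i ≤ β * (M.snr i t / (1 + K) ^ 2) := by
        intro i
        have h1 := (Finset.single_le_sum (fun i _ => hterm i) (Finset.mem_univ i)).trans hβt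
        have h2 := mul_le_mul_of_nonneg_right h1
          (div_nonneg (hsnr i).le (by positivity : (0 : ℝ) ≤ (1 + K) ^ 2))
        refine le_trans (le_of_eq ?_) h2
        have := (hsnr i).ne'
        field_simp
      refine ⟨hban β hβ, DataMarket.exists_isEquilibrium_uniformMandate ht hrev hsub hα hβ,
        fun s h => ?_⟩
      obtain ⟨h1, h2⟩ := h.entry_of_uniformMandate ht hrev hsub hα hβ
      refine ⟨h1, fun s₀ h₀ => ?_⟩
      rw [h₀.userPayoff_of_ban hsub hcost hα hβ]
      -- the ban loses the service of at least one platform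
      have hcard : M.lowCostSet.card < K := by
        refine (Finset.card_lt_univ_of_notMem (x := i₀) fun hi => ?_).trans_eq (Fintype.card_fin K)
        exact absurd (DataMarket.mem_lowCostSet.1 hi) (not_lt.2 (le_of_lt hi₀))
      have hcard' : (M.lowCostSet.card : ℝ) + 1 ≤ K := by exact_mod_cast hcard
      linarith [h2 hK]
    · have hentry : ∀ i, i ∈ s.entry ↔ M.LowCost i := fun i =>
        ⟨fun hi => (hcost i).resolve_right fun hh => h.notMem_entry hsub hβ hh
          (fun A => ((marginalValue_le hβ (M.snrs_nonneg _) A i).trans hβε).trans_lt (hεc i hh)) hi,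
          fun hi => (h.lowCost_mem hsub hα hβ hi).1⟩
      refine ⟨hentry, fun s₀ h₀ => ?_⟩
      rw [h₀.userPayoff_of_ban hsub hcost hα hβ]
      exact h.userPayoff_le_ban hsub hα hβ hentry
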